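/- Let $N\ge 2$ and $\beta>0$. For $r>0$ let $B_r\subset\mathbb R^N$ be the open ball of radius $r$ centred at the origin, $|B_r|$ its Lebesgue measure, and let $$\lambda_{1,\beta}(B_r)=\min_{v\in H^1(B_r),\ v\neq 0}\ \frac{\int_{B_r}|\nabla v|^2\,dx+\beta\int_{\partial B_r}v^2\,d\mathcal H^{N-1}}{\int_{B_r}v^2\,dx}$$ be the fundamental eigenvalue of the Robin Laplacian on $B_r$, where in the boundary integral $v$ is understood in the sense of traces. Then for every $k>0$ the function $f(r)=\lambda_{1,\beta}(B_r)+k|B_r|$ is uniformly convex on $(0,\infty)$, with a quadratic modulus of convexity: there is a constant $m>0$ (depending on $N$, $\beta$ and $k$) such that for all $r,s>0$ and all $t\in[0,1]$ $$f\big(tr+(1-t)s\big)\le t f(r)+(1-t)f(s)-\frac m2\,t(1-t)\,|r-s|^2 .$$ -/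

import Mathlib

open MeasureTheory Filter Topology Set Metric
open scoped Gradient ContDiff ENNReal

noncomputable section

namespace Robin

/-- The surface measure on the boundary of `Ω ⊆ ℝᴺ`: the `(N - 1)`-dimensional Hausdorff measure
(in its Euclidean normalization), restricted to the topological boundary of `Ω`. -/
def boundaryMeasure {N : ℕ} (Ω : Set (EuclideanSpace ℝ (Fin N))) :
    Measure (EuclideanSpace ℝ (Fin N)) :=
  (μHE[N - 1] : Measure (EuclideanSpace ℝ (Fin N))).restrict (frontier Ω)

/-- `G` is the weak gradient of `v` on the open set `Ω`:
`∫_Ω v ∇φ = - ∫_Ω φ G` for all test functions `φ ∈ C_c^∞(Ω)`. -/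
def IsWeakGradient {N : ℕ} (Ω : Set (EuclideanSpace ℝ (Fin N)))
    (v : EuclideanSpace ℝ (Fin N) → ℝ)
    (G : EuclideanSpace ℝ (Fin N) → EuclideanSpace ℝ (Fin N)) : Prop :=
  ∀ φ : EuclideanSpace ℝ (Fin N) → ℝ, ContDiff ℝ ∞ φ → HasCompactSupport φ → tsupport φ ⊆ Ω →
    ∫ x in Ω, v x • ∇ φ x = -∫ x in Ω, φ x • G x

/-- `v ∈ H¹(Ω)`, with weak gradient `G`. -/
structure IsH1 {N : ℕ} (Ω : Set (EuclideanSpace ℝ (Fin N)))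
    (v : EuclideanSpace ℝ (Fin N) → ℝ)
    (G : EuclideanSpace ℝ (Fin N) → EuclideanSpace ℝ (Fin N)) : Prop where
  memLp : MemLp v 2 (volume.restrict Ω)
  memLp_gradient : MemLp G 2 (volume.restrict Ω)
  isWeakGradient : IsWeakGradient Ω v G

/-- `τ ∈ L²(∂Ω)` is the boundary trace of the function `v ∈ H¹(Ω)` with weak gradient `G`.
The trace operator `H¹(Ω) → L²(∂Ω)` is the continuous extension of the restriction `φ ↦ φ|_∂Ω`
of functions that are `C¹` up to the boundary: `τ` is the `L²(∂Ω)`-limit of the boundary values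
of `C¹` functions that converge to `v` in `H¹(Ω)`. -/
def IsTrace {N : ℕ} (Ω : Set (EuclideanSpace ℝ (Fin N)))
    (v : EuclideanSpace ℝ (Fin N) → ℝ)
    (G : EuclideanSpace ℝ (Fin N) → EuclideanSpace ℝ (Fin N))
    (τ : EuclideanSpace ℝ (Fin N) → ℝ) : Prop :=
  MemLp τ 2 (boundaryMeasure Ω) ∧
  ∃ φ : ℕ → EuclideanSpace ℝ (Fin N) → ℝ, (∀ n, ContDiff ℝ 1 (φ n)) ∧
    Tendsto (fun n => eLpNorm (fun x => φ n x - v x) 2 (volume.restrict Ω)) atTop (𝓝 0) ∧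
    Tendsto (fun n => eLpNorm (fun x => ∇ (φ n) x - G x) 2 (volume.restrict Ω)) atTop (𝓝 0) ∧
    Tendsto (fun n => eLpNorm (fun x => φ n x - τ x) 2 (boundaryMeasure Ω)) atTop (𝓝 0)

/-- The Robin Rayleigh quotient
`(∫_Ω |∇v|² + β ∫_∂Ω v² dℋ^{N-1}) / ∫_Ω v²` of a function `v` with gradient `G` and trace `τ`. -/
def rayleighQuotient {N : ℕ} (β : ℝ) (Ω : Set (EuclideanSpace ℝ (Fin N)))
    (v : EuclideanSpace ℝ (Fin N) → ℝ)
    (G : EuclideanSpace ℝ (Fin N) → EuclideanSpace ℝ (Fin N))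
    (τ : EuclideanSpace ℝ (Fin N) → ℝ) : ℝ :=
  ((∫ x in Ω, ‖G x‖ ^ 2) + β * ∫ x, τ x ^ 2 ∂(boundaryMeasure Ω)) / ∫ x in Ω, v x ^ 2

/-- The fundamental Robin eigenvalue `λ_{1,β}(Ω)` of a bounded Lipschitz domain `Ω`: the minimum of
the Rayleigh quotient over the nonzero elements of `H¹(Ω)`. -/
def eigenvalue {N : ℕ} (β : ℝ) (Ω : Set (EuclideanSpace ℝ (Fin N))) : ℝ :=
  sInf {q : ℝ | ∃ v G τ, IsH1 Ω v G ∧ IsTrace Ω v G τ ∧ ¬ v =ᵐ[volume.restrict Ω] 0 ∧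
    q = rayleighQuotient β Ω v G τ}

end Robin

end

/-! The fundamental eigenfunction of a ball is radial, `x ↦ H (L ‖x‖²)`, where `H` is an entire
function given by its Taylor series and `L` is the eigenvalue. The Robin condition on the sphere of
radius `r` reads `φ (L r²) = b r`, where `φ z = -2 z H' z / H z` and `b` is the boundary parameter.
The equation for `H` becomes the Riccati equation `2 z φ' = z - (N - 2) φ + φ²`. From it, `φ` is an
increasing bijection from the interval where `H` stays positive onto `(0, ∞)`, which defines `L r`.

Convexity is then a question about one ordinary differential equation. With `n = N - 1` and `p = L r
/ b + b r - n` it reads `L' = -(2 L / r) p / (p + 1)`, and differentiating again, `L'' = 2 L / (r²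
(p + 1)²) · (-W)` with `W = r p' - 3 p² - p`. As `r → 0`, `p → 1` and `W → -4`; wherever `W`
vanishes, `W' = (-2 n - 18 p³) / r < 0`, so `W` never reaches zero and `L'' > 0`
(`convexityDefect_neg`). Moreover `L''` blows up at `0`, while away from `0` the volume term `K r ^
N`, `N ≥ 2`, has second derivative bounded below. Together they give a uniform modulus
(`exists_strongConvexOn`).

That `L` is the minimum of the Rayleigh quotient (`eigenvalue_ball_eq`) follows ray by ray: with `y
= -u'/u` for the positive radial solution `u`, the Robin energy minus `L` times the mass is the
integral of the square `(w' + y w)²` (`ray_energy_eq`), which vanishes for `w = u`. Integration over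
rays yields the cone measure on the sphere, whereas the boundary term uses Hausdorff measure. The
two are rotation invariant, hence proportional (`exists_unitSphereMeasure_eq`). The ratio `c` need
not be known: it is absorbed in `b = β c`. -/

noncomputable section

namespace Robin

/-! ### Power series dominated by the exponential series -/

/-- The sum of the real power series with coefficients `a`. -/
def powSum (a : ℕ → ℝ) (x : ℝ) : ℝ := ∑' k, a k * x ^ k

/-- The coefficients of the derivative of a power series. -/
def derivCoeff (a : ℕ → ℝ) (k : ℕ) : ℝ := (k + 1) * a (k + 1)

/-- The coefficients `a` are dominated by those of the exponential series. -/
def ExpBounded (a : ℕ → ℝ) : Prop := ∀ k, |a k| ≤ 1 / (k.factorial : ℝ)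

theorem ExpBounded.derivCoeff {a : ℕ → ℝ} (ha : ExpBounded a) : ExpBounded (derivCoeff a) := by
  intro k
  have h := ha (k + 1)
  rw [Robin.derivCoeff, abs_mul, abs_of_nonneg (by positivity : (0 : ℝ) ≤ k + 1)]
  calc ((k : ℝ) + 1) * |a (k + 1)| ≤ (k + 1) * (1 / ((k + 1).factorial : ℝ)) := by gcongr
    _ = 1 / (k.factorial : ℝ) := by
      rw [Nat.factorial_succ]; push_cast
      field_simp

theorem ExpBounded.summable {a : ℕ → ℝ} (ha : ExpBounded a) (x : ℝ) :
    Summable fun k => a k * x ^ k := by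
  refine Summable.of_norm_bounded (g := fun k => |x| ^ k / (k.factorial : ℝ))
    (Real.summable_pow_div_factorial _) fun k => ?_
  rw [Real.norm_eq_abs, abs_mul, abs_pow, div_eq_mul_one_div, mul_comm (|x| ^ k)]
  exact mul_le_mul_of_nonneg_right (ha k) (by positivity)

/-- Termwise differentiation is legitimate on the ball of radius `|x| + 1`: after a shift of index,
the differentiated series is dominated there by an exponential series. -/
theorem ExpBounded.hasDerivAt {a : ℕ → ℝ} (ha : ExpBounded a) (x : ℝ) :
    HasDerivAt (powSum a) (powSum (Robin.derivCoeff a) x) x := by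
  set R := |x| + 1
  have key : HasDerivAt (fun z => ∑' k, a k * z ^ k) (∑' k : ℕ, a k * (k * x ^ (k - 1))) x := by
    refine hasDerivAt_tsum_of_isPreconnected (t := ball (0 : ℝ) R) (y₀ := 0)
      (u := fun k : ℕ => |a k| * (k * R ^ (k - 1)))
      (g := fun k z => a k * z ^ k) (g' := fun k z => a k * (k * z ^ (k - 1)))
      ?_ isOpen_ball (convex_ball _ _).isPreconnected (fun k y _ => ?_) (fun k y hy => ?_) ?_ ?_ ?_
    · rw [← summable_nat_add_iff 1]
      refine Summable.of_nonneg_of_le (fun k => by positivity) (fun k => ?_)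
        (Real.summable_pow_div_factorial R)
      have := ha.derivCoeff k
      rw [Robin.derivCoeff, abs_mul, abs_of_nonneg (by positivity : (0 : ℝ) ≤ k + 1)] at this
      calc |a (k + 1)| * (((k + 1 : ℕ) : ℝ) * R ^ (k + 1 - 1))
          = ((k : ℝ) + 1) * |a (k + 1)| * R ^ k := by push_cast [Nat.add_sub_cancel]; ring
        _ ≤ 1 / (k.factorial : ℝ) * R ^ k := by gcongr
        _ = R ^ k / k.factorial := by ring
    · exact (hasDerivAt_pow k y).const_mul (a k)
    · rw [mem_ball_zero_iff, Real.norm_eq_abs] at hy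
      rw [Real.norm_eq_abs, abs_mul, abs_mul, abs_pow, Nat.abs_cast]
      gcongr
    · exact mem_ball_self (by positivity)
    · exact ha.summable 0
    · rw [mem_ball_zero_iff, Real.norm_eq_abs]; linarith
  refine key.congr_deriv ?_
  have hs : Summable fun k : ℕ => a k * (k * x ^ (k - 1)) := by
    rw [← summable_nat_add_iff 1]
    refine (ha.derivCoeff.summable x).congr fun k => ?_
    simp [Robin.derivCoeff]; ring
  rw [hs.tsum_eq_zero_add]
  simp only [powSum, Robin.derivCoeff, Nat.cast_zero, zero_mul, mul_zero, zero_add,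
    Nat.add_sub_cancel, Nat.cast_add, Nat.cast_one]
  exact tsum_congr fun k => by ring

theorem powSum_zero (a : ℕ → ℝ) : powSum a 0 = a 0 := by
  rw [powSum, tsum_eq_single 0]
  · simp
  · intro k hk; simp [hk]

/-! ### The radial profile and its differential equation -/

/-- The Taylor coefficients of the entire function `H` for which `x ↦ H (‖x‖²)` is the radial
solution of `Δu + u = 0` in `ℝᴺ` with `u 0 = 1`. -/
def radialCoeff (N : ℕ) : ℕ → ℝ
  | 0 => 1
  | k + 1 => -radialCoeff N k / ((k + 1) * (4 * k + 2 * N))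

theorem expBounded_radialCoeff {N : ℕ} (hN : 1 ≤ N) : ExpBounded (radialCoeff N) := by
  intro k
  induction k with
  | zero => simp [radialCoeff]
  | succ k ih =>
    have hN' : (1 : ℝ) ≤ N := by exact_mod_cast hN
    have hd : (0 : ℝ) < (k + 1) * (4 * k + 2 * N) := by positivity
    rw [radialCoeff, abs_div, abs_neg, abs_of_pos hd, Nat.factorial_succ]
    push_cast
    rw [div_eq_mul_inv, mul_inv, ← mul_assoc, one_div, mul_inv, mul_comm (_⁻¹) (_⁻¹)]
    have h1 : ((4 : ℝ) * k + 2 * N)⁻¹ ≤ 1 := inv_le_one_of_one_le₀ (by nlinarith [(Nat.cast_nonneg k : (0 : ℝ) ≤ k)])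
    rw [one_div] at ih
    calc |radialCoeff N k| * ((k : ℝ) + 1)⁻¹ * (4 * (k : ℝ) + 2 * N)⁻¹
        ≤ ((k.factorial : ℝ))⁻¹ * ((k : ℝ) + 1)⁻¹ * 1 := by gcongr
      _ = _ := by ring

/-- The radial profile `H`: the function `x ↦ H (‖x‖²)` solves `Δu + u = 0` in `ℝᴺ`. -/
def profile (N : ℕ) : ℝ → ℝ := powSum (radialCoeff N)

/-- The derivative of the radial profile. -/
def profileDeriv (N : ℕ) : ℝ → ℝ := powSum (derivCoeff (radialCoeff N))

/-- The second derivative of the radial profile. -/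
def profileDeriv₂ (N : ℕ) : ℝ → ℝ := powSum (derivCoeff (derivCoeff (radialCoeff N)))

theorem hasDerivAt_profile {N : ℕ} (hN : 1 ≤ N) (x : ℝ) :
    HasDerivAt (profile N) (profileDeriv N x) x :=
  (expBounded_radialCoeff hN).hasDerivAt x

theorem hasDerivAt_profileDeriv {N : ℕ} (hN : 1 ≤ N) (x : ℝ) :
    HasDerivAt (profileDeriv N) (profileDeriv₂ N x) x :=
  (expBounded_radialCoeff hN).derivCoeff.hasDerivAt x

theorem profile_zero (N : ℕ) : profile N 0 = 1 := by
  simp [profile, powSum_zero, radialCoeff]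

theorem profileDeriv_zero (N : ℕ) : profileDeriv N 0 = -1 / (2 * N) := by
  simp [profileDeriv, powSum_zero, derivCoeff, radialCoeff]

theorem continuous_profile {N : ℕ} (hN : 1 ≤ N) : Continuous (profile N) :=
  continuous_iff_continuousAt.2 fun x => (hasDerivAt_profile hN x).continuousAt

theorem continuous_profileDeriv {N : ℕ} (hN : 1 ≤ N) : Continuous (profileDeriv N) :=
  continuous_iff_continuousAt.2 fun x => (hasDerivAt_profileDeriv hN x).continuousAt

theorem contDiff_profile {N : ℕ} (hN : 1 ≤ N) : ContDiff ℝ 1 (profile N) := by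
  rw [contDiff_one_iff_deriv]
  refine ⟨fun x => (hasDerivAt_profile hN x).differentiableAt, ?_⟩
  have : deriv (profile N) = profileDeriv N := funext fun x => (hasDerivAt_profile hN x).deriv
  rw [this]
  exact continuous_profileDeriv hN

/-- This is the radial form of `Δu + u = 0` in the variable `x = ρ²`. On coefficients it is the
recursion `(k + 1) (4 k + 2 N) a (k + 1) = -a k` defining `radialCoeff`. -/
theorem profile_ode {N : ℕ} (hN : 1 ≤ N) (x : ℝ) :
    4 * x * profileDeriv₂ N x + 2 * N * profileDeriv N x + profile N x = 0 := by
  have h := expBounded_radialCoeff hN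
  have s0 := h.summable x
  have s1 := h.derivCoeff.summable x
  have s2 := h.derivCoeff.derivCoeff.summable x
  have e2 : x * profileDeriv₂ N x = ∑' k : ℕ, (k * (k + 1) * radialCoeff N (k + 1)) * x ^ k := by
    have hs : Summable fun k : ℕ => (k * (k + 1) * radialCoeff N (k + 1)) * x ^ k := by
      rw [← summable_nat_add_iff 1]
      refine (s2.mul_left x).congr fun k => ?_
      simp only [derivCoeff]; push_cast; ring
    rw [hs.tsum_eq_zero_add, profileDeriv₂, powSum, ← tsum_mul_left]
    simp only [Nat.cast_zero, zero_mul, zero_add]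
    exact tsum_congr fun k => by simp only [derivCoeff]; push_cast; ring
  have hs2 : Summable fun k : ℕ => (k * (k + 1) * radialCoeff N (k + 1)) * x ^ k := by
    rw [← summable_nat_add_iff 1]
    refine (s2.mul_left x).congr fun k => ?_
    simp only [derivCoeff]; push_cast; ring
  rw [mul_assoc, e2, profileDeriv, profile, powSum, powSum, ← tsum_mul_left, ← tsum_mul_left,
    ← (hs2.mul_left 4).tsum_add (s1.mul_left _),
    ← ((hs2.mul_left 4).add (s1.mul_left _)).tsum_add s0]
  refine (tsum_congr fun k => ?_).trans tsum_zero
  have hN' : (1 : ℝ) ≤ N := by exact_mod_cast hN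
  simp only [derivCoeff, radialCoeff]
  have : (4 * (k : ℝ) + 2 * N) ≠ 0 := by positivity
  field_simp
  ring

/-! ### Convexity of solutions of the eigenvalue equation -/

/-- A function on an open initial segment of `(0, ∞)` that is negative near `0` and decreasing at
each of its zeros is negative. -/
theorem neg_of_deriv_neg_at_zeros {s : Set ℝ} (hs : IsOpen s) (hs0 : s ⊆ Ioi 0)
    (hs' : ∀ r ∈ s, Ioc 0 r ⊆ s) {g g' : ℝ → ℝ} (hd : ∀ r ∈ s, HasDerivAt g (g' r) r)
    (h0 : ∀ᶠ r in 𝓝[>] 0, g r < 0) (hz : ∀ r ∈ s, g r = 0 → g' r < 0) : ∀ r ∈ s, g r < 0 := by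
  have hle : ∀ r ∈ s, g r ≤ 0 := by
    intro r hr
    have hr0 : 0 < r := hs0 hr
    obtain ⟨a, hga, ha0, har⟩ := (h0.and (Ioo_mem_nhdsGT hr0)).exists
    have hsub : Icc a r ⊆ s := fun x hx => hs' r hr ⟨ha0.trans_le hx.1, hx.2⟩
    exact image_le_of_deriv_right_lt_deriv_boundary (f := g) (f' := g') (B := fun _ => 0)
      (B' := fun _ => 0) (a := a) (b := r)
      (fun x hx => (hd x (hsub hx)).continuousAt.continuousWithinAt)
      (fun x hx => (hd x (hsub (Ico_subset_Icc_self hx))).hasDerivWithinAt) hga.le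
      (fun x => hasDerivAt_const x 0)
      (fun x hx h => hz x (hsub (Ico_subset_Icc_self hx)) h) ⟨har.le, le_rfl⟩
  intro r hr
  -- Once `g ≤ 0` on the open set `s`, a zero would be a local maximum, forcing a vanishing
  -- derivative there.
  refine lt_of_le_of_ne (hle r hr) fun h => (hz r hr h).ne ?_
  refine IsLocalMax.hasDerivAt_eq_zero ?_ (hd r hr)
  filter_upwards [hs.mem_nhds hr] with x hx
  rw [h]; exact hle x hx

/-- Substituting `L = b (P + n - b r) / r` eliminates `L`, so the derivative depends on `P` and `r`
only and its sign can be read off at critical values of `P`. -/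
theorem hasDerivAt_slopeRatio {n b : ℝ} (hb : 0 < b) {L : ℝ → ℝ} {r P : ℝ} (hr : 0 < r)
    (hP : P = L r * r / b + b * r - n) (hP1 : 0 < P + 1)
    (hL : HasDerivAt L (-(2 * L r / r) * (P / (P + 1))) r) :
    HasDerivAt (fun r => L r * r / b + b * r - n)
      ((2 * b * r * P + (P + n) * (1 - P)) / (1 + P) / r) r := by
  have h : HasDerivAt (fun r => L r * r / b + b * r - n) _ r :=
    (((hL.mul (hasDerivAt_id r)).div_const b).add ((hasDerivAt_id r).const_mul b)).sub_const n
  refine h.congr_deriv ?_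
  have hLr : L r = b * (P + n - b * r) / r := by rw [hP]; field_simp; ring
  have : 1 + P ≠ 0 := by linarith
  have : P + 1 ≠ 0 := by linarith
  rw [hLr, id]
  field_simp
  ring

section ode

variable {n b : ℝ} {L p : ℝ → ℝ}

theorem tendsto_slopeRatio (hb : 0 < b) (hp : p = fun r => L r * r / b + b * r - n)
    (h0 : Tendsto (fun r => L r * r) (𝓝[>] 0) (𝓝 ((n + 1) * b))) :
    Tendsto p (𝓝[>] 0) (𝓝 1) := by
  have hid : Tendsto (fun r : ℝ => r) (𝓝[>] 0) (𝓝 0) := tendsto_nhdsWithin_of_tendsto_nhds tendsto_id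
  have := ((h0.div_const b).add (hid.const_mul b)).sub_const n
  rw [hp]
  convert this using 2
  field_simp; ring

/-- The ratio starts near `1`, and where it vanishes its derivative is `n / r > 0`, so the barrier
argument applies to `-p`. -/
theorem slopeRatio_pos (hn : 0 < n) (hb : 0 < b) (hp : p = fun r => L r * r / b + b * r - n)
    (hp1 : ∀ r ∈ Ioi (0 : ℝ), 0 < p r + 1)
    (hL : ∀ r ∈ Ioi (0 : ℝ), HasDerivAt L (-(2 * L r / r) * (p r / (p r + 1))) r)
    (h0 : Tendsto (fun r => L r * r) (𝓝[>] 0) (𝓝 ((n + 1) * b))) :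
    ∀ r ∈ Ioi (0 : ℝ), 0 < p r := by
  have hd : ∀ r ∈ Ioi (0 : ℝ), HasDerivAt (fun r => - p r)
      (-((2 * b * r * p r + (p r + n) * (1 - p r)) / (1 + p r) / r)) r := fun r hr => by
    have := (hasDerivAt_slopeRatio (n := n) hb hr (by rw [hp]) (hp1 r hr) (hL r hr)).neg
    rwa [← hp] at this
  have := neg_of_deriv_neg_at_zeros isOpen_Ioi subset_rfl
    (fun r _ x hx => hx.1) hd ?_ ?_
  · intro r hr; have := this r hr; linarith
  · filter_upwards [(tendsto_slopeRatio hb hp h0).eventually (lt_mem_nhds one_pos)] with r hr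
    linarith
  · intro r (hr : 0 < r) h
    have h' : p r = 0 := by linarith
    simp only [h']
    simp
    positivity

/-- The quantity whose sign is opposite to that of the second derivative of the eigenvalue. -/
def convexityDefect (n b r P : ℝ) : ℝ :=
  (2 * b * r * P + (P + n) * (1 - P)) / (1 + P) - 3 * P ^ 2 - P

theorem convexityDefect_neg (hn : 0 < n) (hb : 0 < b) (hp : p = fun r => L r * r / b + b * r - n)
    (hp1 : ∀ r ∈ Ioi (0 : ℝ), 0 < p r + 1)
    (hL : ∀ r ∈ Ioi (0 : ℝ), HasDerivAt L (-(2 * L r / r) * (p r / (p r + 1))) r)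
    (h0 : Tendsto (fun r => L r * r) (𝓝[>] 0) (𝓝 ((n + 1) * b))) :
    ∀ r ∈ Ioi (0 : ℝ), convexityDefect n b r (p r) < 0 := by
  have hpos := slopeRatio_pos hn hb hp hp1 hL h0
  have hdp : ∀ r ∈ Ioi (0 : ℝ), HasDerivAt p
      ((2 * b * r * p r + (p r + n) * (1 - p r)) / (1 + p r) / r) r := fun r hr => by
    have := hasDerivAt_slopeRatio (n := n) hb hr (by rw [hp]) (hp1 r hr) (hL r hr)
    rwa [← hp] at this
  have hd : ∀ r ∈ Ioi (0 : ℝ), HasDerivAt (fun r => convexityDefect n b r (p r)) _ r :=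
    fun r hr => (((((((hasDerivAt_id r).const_mul (2 * b)).mul (hdp r hr)).add
      (((hdp r hr).add_const n).mul ((hdp r hr).const_sub 1))).div ((hdp r hr).const_add 1)
      (by have := hp1 r hr; linarith)).sub (((hdp r hr).pow 2).const_mul 3)).sub (hdp r hr))
  refine neg_of_deriv_neg_at_zeros isOpen_Ioi subset_rfl (fun r _ x hx => hx.1) hd ?_ ?_
  · have hid : Tendsto (fun r : ℝ => r) (𝓝[>] 0) (𝓝 0) :=
      tendsto_nhdsWithin_of_tendsto_nhds tendsto_id
    have hpt := tendsto_slopeRatio hb hp h0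
    have : Tendsto (fun r => convexityDefect n b r (p r)) (𝓝[>] 0)
        (𝓝 (convexityDefect n b 0 1)) := by
      unfold convexityDefect
      refine (((((hid.const_mul (2 * b)).mul hpt).add ((hpt.add_const n).mul
        (hpt.const_sub 1))).div (hpt.const_add 1) (by norm_num)).sub
        ((hpt.pow 2).const_mul 3)).sub hpt
    refine this.eventually (gt_mem_nhds ?_)
    norm_num [convexityDefect]
  · intro r (hr : 0 < r) h
    have hP := hpos r hr
    set P := p r
    have h1 : 1 + P ≠ 0 := by positivity
    have hQ : (2 * b * r * P + (P + n) * (1 - P)) / (1 + P) = 3 * P ^ 2 + P := by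
      unfold convexityDefect at h; linarith
    -- The condition `W = 0` is linear in `b`. Solving it for `b` eliminates this parameter, and the
    -- derivative of `W` collapses to `(-2 n - 18 P³) / r`.
    have hb' : b = ((1 + P) * (3 * P ^ 2 + P) - (P + n) * (1 - P)) / (2 * r * P) := by
      rw [← hQ]; field_simp; ring
    simp only [id, Pi.add_apply, Pi.mul_apply, hQ]
    have : ∀ x : ℝ, x = (-2 * n - 18 * P ^ 3) / r → x < 0 := by
      rintro x rfl
      exact div_neg_of_neg_of_pos (by nlinarith [pow_pos hP 3]) hr
    apply this
    rw [hb']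
    field_simp
    ring

theorem hasDerivAt_slope (hb : 0 < b) (hp : p = fun r => L r * r / b + b * r - n)
    (hp1 : ∀ r ∈ Ioi (0 : ℝ), 0 < p r + 1)
    (hL : ∀ r ∈ Ioi (0 : ℝ), HasDerivAt L (-(2 * L r / r) * (p r / (p r + 1))) r) {r : ℝ}
    (hr : 0 < r) :
    HasDerivAt (fun r => -(2 * L r / r) * (p r / (p r + 1)))
      (2 * L r / r ^ 2 / (p r + 1) ^ 2 * -convexityDefect n b r (p r)) r := by
  have hdp := hasDerivAt_slopeRatio (n := n) hb hr (by rw [hp]) (hp1 r hr) (hL r hr)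
  rw [← hp] at hdp
  have hP := hp1 r hr
  have h : HasDerivAt (fun r => -(2 * L r / r) * (p r / (p r + 1))) _ r :=
    ((((hL r hr).const_mul 2).div (hasDerivAt_id r) hr.ne').neg).mul
      (hdp.div (hdp.add_const 1) hP.ne')
  refine h.congr_deriv ?_
  have : 1 + p r ≠ 0 := by linarith
  have : p r + 1 ≠ 0 := hP.ne'
  simp only [id, Pi.neg_apply, Pi.div_apply]
  unfold convexityDefect
  field_simp
  ring

/-- Since `L r * r`, `p` and the defect tend to `(n + 1) b`, `1` and `-4`, the expression is `r⁻³`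
times a factor with positive limit. -/
theorem tendsto_slope_deriv (hn : 0 < n) (hb : 0 < b)
    (hp : p = fun r => L r * r / b + b * r - n)
    (h0 : Tendsto (fun r => L r * r) (𝓝[>] 0) (𝓝 ((n + 1) * b))) :
    Tendsto (fun r => 2 * L r / r ^ 2 / (p r + 1) ^ 2 * -convexityDefect n b r (p r))
      (𝓝[>] 0) atTop := by
  have hid : Tendsto (fun r : ℝ => r) (𝓝[>] 0) (𝓝 0) :=
    tendsto_nhdsWithin_of_tendsto_nhds tendsto_id
  have hpt := tendsto_slopeRatio hb hp h0
  have hW : Tendsto (fun r => convexityDefect n b r (p r)) (𝓝[>] 0)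
      (𝓝 (convexityDefect n b 0 1)) := by
    unfold convexityDefect
    refine (((((hid.const_mul (2 * b)).mul hpt).add ((hpt.add_const n).mul
      (hpt.const_sub 1))).div (hpt.const_add 1) (by norm_num)).sub
      ((hpt.pow 2).const_mul 3)).sub hpt
  have h1 : Tendsto (fun r => 2 * (L r * r) / (p r + 1) ^ 2 * -convexityDefect n b r (p r))
      (𝓝[>] 0) (𝓝 (2 * ((n + 1) * b) / (1 + 1) ^ 2 * -convexityDefect n b 0 1)) :=
    ((h0.const_mul 2).div ((hpt.add_const 1).pow 2) (by norm_num)).mul hW.neg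
  have h2 : Tendsto (fun r : ℝ => (r ^ 3)⁻¹) (𝓝[>] 0) atTop := by
    refine Tendsto.inv_tendsto_nhdsGT_zero (tendsto_nhdsWithin_iff.2 ⟨?_, ?_⟩)
    · simpa using hid.pow 3
    · filter_upwards [self_mem_nhdsWithin] with r (hr : 0 < r)
      exact pow_pos hr 3
  refine (h1.pos_mul_atTop (by norm_num [convexityDefect]; positivity) h2).congr' ?_
  filter_upwards [self_mem_nhdsWithin] with r (hr : 0 < r)
  field_simp

/-- Adding a multiple of `r ^ (n + 1)`, `n ≥ 1`, to a solution of the eigenvalue equation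
yields a strongly convex function. -/
theorem exists_strongConvexOn {n : ℕ} (hn : 1 ≤ n) (hb : 0 < b)
    (hp : p = fun r => L r * r / b + b * r - n) (hLpos : ∀ r ∈ Ioi (0 : ℝ), 0 < L r)
    (hp1 : ∀ r ∈ Ioi (0 : ℝ), 0 < p r + 1)
    (hL : ∀ r ∈ Ioi (0 : ℝ), HasDerivAt L (-(2 * L r / r) * (p r / (p r + 1))) r)
    (h0 : Tendsto (fun r => L r * r) (𝓝[>] 0) (𝓝 ((n + 1) * b))) {K : ℝ} (hK : 0 < K) :
    ∃ m : ℝ, 0 < m ∧ StrongConvexOn (Ioi (0 : ℝ)) m (fun r => L r + K * r ^ (n + 1)) := by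
  have hn' : (0 : ℝ) < n := by exact_mod_cast hn
  have hnn : ((n + 1 : ℕ) : ℝ) = n + 1 := by push_cast; rfl
  set L₂ : ℝ → ℝ := fun r => 2 * L r / r ^ 2 / (p r + 1) ^ 2 * -convexityDefect n b r (p r)
  have hL₂ : ∀ r ∈ Ioi (0 : ℝ), 0 ≤ L₂ r := fun r (hr : 0 < r) => by
    have h1 := convexityDefect_neg hn' hb hp hp1 hL h0 r hr
    have h2 := hLpos r hr
    have h3 := hp1 r hr
    have h4 : 0 ≤ -convexityDefect n b r (p r) := by linarith
    positivity
  obtain ⟨ρ, hρ0, hρ⟩ : ∃ ρ : ℝ, 0 < ρ ∧ ∀ r ∈ Ioo 0 ρ, 1 ≤ L₂ r := by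
    have := (tendsto_slope_deriv hn' hb hp h0).eventually (eventually_ge_atTop 1)
    obtain ⟨ρ, hρ0, hρ⟩ := (mem_nhdsGT_iff_exists_Ioo_subset).1 this
    exact ⟨ρ, hρ0, fun r hr => hρ hr⟩
  -- Below `ρ` the eigenvalue alone contributes second derivative at least `1`; from `ρ` on, the
  -- volume term contributes at least its value at `ρ`, which is positive because `n ≥ 1`.
  set m := min 1 (K * ((n + 1) * (n * ρ ^ (n - 1))))
  refine ⟨m, lt_min one_pos (by positivity), strongConvexOn_iff_convex.2 ?_⟩
  have hderiv : ∀ r ∈ Ioi (0 : ℝ), HasDerivAt (fun r => L r + K * r ^ (n + 1) - m / 2 * ‖r‖ ^ 2)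
      (-(2 * L r / r) * (p r / (p r + 1)) + K * ((n + 1) * r ^ n) - m * r) r := fun r hr => by
    have : HasDerivAt (fun r : ℝ => L r + K * r ^ (n + 1) - m / 2 * r ^ 2) _ r :=
      ((hL r hr).add ((hasDerivAt_pow (n + 1) r).const_mul K)).sub
        ((hasDerivAt_pow 2 r).const_mul (m / 2))
    simp only [Real.norm_eq_abs, sq_abs]
    refine this.congr_deriv ?_
    push_cast
    simp
    ring
  have hderiv₂ : ∀ r ∈ Ioi (0 : ℝ), HasDerivAt
      (fun r => -(2 * L r / r) * (p r / (p r + 1)) + K * ((n + 1) * r ^ n) - m * r)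
      (L₂ r + K * ((n + 1) * (n * r ^ (n - 1))) - m) r := fun r hr => by
    have : HasDerivAt
      (fun r => -(2 * L r / r) * (p r / (p r + 1)) + K * ((n + 1) * r ^ n) - m * r) _ r :=
      ((hasDerivAt_slope hb hp hp1 hL hr).add
        (((hasDerivAt_pow n r).const_mul ((n : ℝ) + 1)).const_mul K)).sub
        ((hasDerivAt_id r).const_mul m)
    refine this.congr_deriv ?_
    simp [L₂]
  refine convexOn_of_hasDerivWithinAt2_nonneg (convex_Ioi 0)
    (fun r hr => (hderiv r hr).continuousAt.continuousWithinAt)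
    (fun r hr => (hderiv r (interior_subset hr)).hasDerivWithinAt)
    (fun r hr => (hderiv₂ r (interior_subset hr)).hasDerivWithinAt) fun r hr => ?_
  have hr : 0 < r := interior_subset hr
  rcases lt_or_ge r ρ with h | h
  · have h1 : m ≤ 1 := min_le_left _ _
    have h2 := hρ r ⟨hr, h⟩
    have h3 : 0 ≤ K * ((n + 1) * (n * r ^ (n - 1))) := by positivity
    linarith
  · have h1 : m ≤ _ := min_le_right _ _
    have h2 := hL₂ r hr
    have h3 : K * ((n + 1) * (n * ρ ^ (n - 1))) ≤ K * ((n + 1) * (n * r ^ (n - 1))) := by gcongr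
    linarith

end ode

/-! ### The Robin parameter and its inverse -/

/-- The set of `z > 0` such that the radial profile is positive on `[0, z]`. -/
def profileDomain (N : ℕ) : Set ℝ := {z | 0 < z ∧ ∀ x ∈ Icc 0 z, 0 < profile N x}

/-- The Robin parameter `-r u'(r) / u(r)`, in terms of `z = λ r²`, of the positive radial
eigenfunction on a ball. -/
def robinParam (N : ℕ) (z : ℝ) : ℝ := -2 * z * profileDeriv N z / profile N z

theorem profileDomain_subset (N : ℕ) : profileDomain N ⊆ Ioi 0 := fun _ h => h.1

theorem Ioc_subset_profileDomain {N : ℕ} {z : ℝ} (hz : z ∈ profileDomain N) :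
    Ioc 0 z ⊆ profileDomain N :=
  fun _ hx => ⟨hx.1, fun y hy => hz.2 y ⟨hy.1, hy.2.trans hx.2⟩⟩

theorem profile_pos_of_mem {N : ℕ} {z : ℝ} (hz : z ∈ profileDomain N) : 0 < profile N z :=
  hz.2 z ⟨hz.1.le, le_rfl⟩

theorem isOpen_profileDomain {N : ℕ} (hN : 1 ≤ N) : IsOpen (profileDomain N) := by
  rw [Metric.isOpen_iff]
  intro z hz
  obtain ⟨ε, hε, h⟩ := Metric.isOpen_iff.1
    ((isOpen_Ioi.preimage (continuous_profile hN)).inter isOpen_Ioi) z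
    ⟨profile_pos_of_mem hz, hz.1⟩
  refine ⟨ε, hε, fun y hy => ⟨(h hy).2, fun x hx => ?_⟩⟩
  rcases le_total x z with hxz | hxz
  · exact hz.2 x ⟨hx.1, hxz⟩
  · refine (h (?_ : x ∈ ball z ε)).1
    rw [mem_ball, Real.dist_eq] at hy ⊢
    rw [abs_of_nonneg (by linarith)]
    linarith [hx.2, (abs_lt.1 hy).2]

theorem convex_profileDomain (N : ℕ) : Convex ℝ (profileDomain N) := by
  refine Set.OrdConnected.convex ⟨fun x hx y hy z hz => ?_⟩
  exact Ioc_subset_profileDomain hy ⟨hx.1.trans_le hz.1, hz.2⟩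

theorem eventually_mem_profileDomain {N : ℕ} (hN : 1 ≤ N) :
    ∀ᶠ z in 𝓝[>] 0, z ∈ profileDomain N := by
  obtain ⟨ε, hε, h⟩ := Metric.isOpen_iff.1
    ((isOpen_Ioi (a := (0 : ℝ))).preimage (continuous_profile hN)) 0 (by simp [profile_zero])
  filter_upwards [Ioo_mem_nhdsGT hε] with z hz
  refine ⟨hz.1, fun x hx => h ?_⟩
  rw [mem_ball_zero_iff, Real.norm_eq_abs, abs_of_nonneg hx.1]
  exact hx.2.trans_lt hz.2

/-- `2 z` times the derivative of the Robin parameter. -/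
def robinParamSlope (N : ℕ) (z : ℝ) : ℝ :=
  z - (N - 2) * robinParam N z + robinParam N z ^ 2

/-- Eliminating `H''` by `profile_ode` leaves a Riccati equation for the Robin parameter. -/
theorem hasDerivAt_robinParam {N : ℕ} (hN : 1 ≤ N) {z : ℝ} (hz : z ∈ profileDomain N) :
    HasDerivAt (robinParam N) (robinParamSlope N z / (2 * z)) z := by
  have hH := profile_pos_of_mem hz
  have h : HasDerivAt (robinParam N) _ z :=
    (((hasDerivAt_id z).const_mul (-2)).mul (hasDerivAt_profileDeriv hN z)).div
      (hasDerivAt_profile hN z) hH.ne'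
  refine h.congr_deriv ?_
  have hz0 := hz.1
  have h2 : profileDeriv₂ N z = -(2 * N * profileDeriv N z + profile N z) / (4 * z) := by
    have := profile_ode hN z
    field_simp
    linarith
  simp only [id, Pi.mul_apply, robinParamSlope, robinParam, h2]
  field_simp
  ring

theorem tendsto_robinParam_div {N : ℕ} (hN : 1 ≤ N) :
    Tendsto (fun z => robinParam N z / z) (𝓝[>] 0) (𝓝 (1 / N)) := by
  have h : Tendsto (fun z => -2 * profileDeriv N z / profile N z) (𝓝[>] 0) (𝓝 (1 / N)) := by
    have hN' : (N : ℝ) ≠ 0 := by positivity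
    have := (((continuous_profileDeriv hN).const_mul (-2)).continuousAt (x := 0)).div
      (continuous_profile hN).continuousAt (by simp [profile_zero])
    have := this.tendsto.mono_left (nhdsWithin_le_nhds (s := Ioi 0))
    have e : ((fun x => -2 * profileDeriv N x) / profile N) 0 = 1 / N := by
      rw [Pi.div_apply, profile_zero, profileDeriv_zero]
      field_simp
    rwa [e] at this
  refine h.congr' ?_
  filter_upwards [self_mem_nhdsWithin] with z (hz : 0 < z)
  rw [robinParam]
  field_simp

theorem tendsto_robinParam_zero {N : ℕ} (hN : 1 ≤ N) :
    Tendsto (robinParam N) (𝓝[>] 0) (𝓝 0) := by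
  have hid : Tendsto (fun r : ℝ => r) (𝓝[>] 0) (𝓝 0) :=
    tendsto_nhdsWithin_of_tendsto_nhds tendsto_id
  have := (tendsto_robinParam_div hN).mul hid
  rw [mul_zero] at this
  refine this.congr' ?_
  filter_upwards [self_mem_nhdsWithin] with z (hz : 0 < z)
  field_simp

/-- Near `0` the slope behaves like `2 z / N`. Where it vanishes, so does the derivative of the
Robin parameter, hence the slope itself has derivative `1` there and cannot cross zero downwards. -/
theorem robinParamSlope_pos {N : ℕ} (hN : 1 ≤ N) :
    ∀ z ∈ profileDomain N, 0 < robinParamSlope N z := by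
  have hd : ∀ z ∈ profileDomain N, HasDerivAt (fun z => -robinParamSlope N z) _ z := fun z hz =>
    (((hasDerivAt_id z).sub ((hasDerivAt_robinParam hN hz).const_mul ((N : ℝ) - 2))).add
      ((hasDerivAt_robinParam hN hz).pow 2)).neg
  have := neg_of_deriv_neg_at_zeros (isOpen_profileDomain hN) (profileDomain_subset N)
    (fun _ => Ioc_subset_profileDomain) hd ?_ ?_
  · intro z hz; have := this z hz; linarith
  · have h1 : Tendsto (fun z => 1 - (N - 2) * (robinParam N z / z) +
        robinParam N z / z * robinParam N z) (𝓝[>] 0) (𝓝 (1 - (N - 2) * (1 / N) + 1 / N * 0)) :=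
      (((tendsto_robinParam_div hN).const_mul _).const_sub _).add
        ((tendsto_robinParam_div hN).mul (tendsto_robinParam_zero hN))
    have hN' : (0 : ℝ) < N := by positivity
    have h2 : (0 : ℝ) < 1 - (N - 2) * (1 / N) + 1 / N * 0 := by
      have : (1 : ℝ) - (N - 2) * (1 / N) + 1 / N * 0 = 2 / N := by field_simp; ring
      rw [this]; positivity
    filter_upwards [h1.eventually (lt_mem_nhds h2), self_mem_nhdsWithin] with z hz (hz0 : 0 < z)
    have : robinParamSlope N z = z * (1 - (N - 2) * (robinParam N z / z) +
        robinParam N z / z * robinParam N z) := by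
      rw [robinParamSlope]; field_simp
    rw [this]
    have := mul_pos hz0 hz
    linarith
  · intro z hz h
    have h0 : robinParamSlope N z = 0 := by linarith
    simp [h0]

theorem strictMonoOn_robinParam {N : ℕ} (hN : 1 ≤ N) :
    StrictMonoOn (robinParam N) (profileDomain N) := by
  refine strictMonoOn_of_hasDerivWithinAt_pos (convex_profileDomain N)
    (fun z hz => (hasDerivAt_robinParam hN hz).continuousAt.continuousWithinAt)
    (fun z hz => (hasDerivAt_robinParam hN (interior_subset hz)).hasDerivWithinAt) fun z hz => ?_
  have h := robinParamSlope_pos hN z (interior_subset hz)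
  have h' := (interior_subset hz : z ∈ profileDomain N).1
  positivity

/-- If `t H + 2 z H'` is positive on `[0, Z)` then `H` is positive on `[0, Z]`. -/
theorem profile_pos_of_forall_Ico {N : ℕ} (hN : 1 ≤ N) {t Z : ℝ} (hZ : 0 < Z)
    (h : ∀ z ∈ Ico 0 Z, 0 < t * profile N z + 2 * z * profileDeriv N z) :
    Z ∈ profileDomain N := by
  refine ⟨hZ, fun x hx => ?_⟩
  obtain ⟨ε, hεd⟩ : ∃ ε, x = 0 ∨ ε ∈ profileDomain N ∧ 0 < ε ∧ ε < x := by
    rcases hx.1.eq_or_lt with h0 | h0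
    · exact ⟨0, Or.inl h0.symm⟩
    · obtain ⟨ε, h1, h2⟩ := ((eventually_mem_profileDomain hN).and (Ioo_mem_nhdsGT h0)).exists
      exact ⟨ε, Or.inr ⟨h1, h2⟩⟩
  rcases hεd with rfl | ⟨hεd, hε0, hεx⟩
  · simp [profile_zero]
  -- The derivative of `z ^ (t / 2) * H` is `z ^ (t / 2 - 1) / 2` times `t H + 2 z H'`. Starting at
  -- `ε > 0` avoids the singularity of the power at `0`.
  have hmono : MonotoneOn (fun z : ℝ => z ^ (t / 2) * profile N z) (Icc ε x) := by
    have hd : ∀ z ∈ Icc ε x, HasDerivAt (fun z : ℝ => z ^ (t / 2) * profile N z)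
        (t / 2 * z ^ (t / 2 - 1) * profile N z + z ^ (t / 2) * profileDeriv N z) z := by
      intro z hz
      have hz0 : 0 < z := hε0.trans_le hz.1
      exact (Real.hasDerivAt_rpow_const (Or.inl hz0.ne')).mul (hasDerivAt_profile hN z)
    refine monotoneOn_of_hasDerivWithinAt_nonneg (convex_Icc _ _)
      (fun z hz => (hd z hz).continuousAt.continuousWithinAt)
      (fun z hz => (hd z (interior_subset hz)).hasDerivWithinAt) fun z hz => ?_
    rw [interior_Icc] at hz
    have hz0 : 0 < z := hε0.trans hz.1
    have e : z ^ (t / 2) = z ^ (t / 2 - 1) * z := by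
      rw [Real.rpow_sub_one hz0.ne']; field_simp
    have := h z ⟨hz0.le, hz.2.trans_le hx.2⟩
    rw [e]
    have h3 := Real.rpow_pos_of_pos hz0 (t / 2 - 1)
    have : 0 < z ^ (t / 2 - 1) * (t * profile N z + 2 * z * profileDeriv N z) := mul_pos h3 this
    linarith
  have h1 := hmono ⟨le_rfl, hεx.le⟩ ⟨hεx.le, le_rfl⟩ hεx.le
  have hx0 := hε0.trans hεx
  have h2 := mul_pos (Real.rpow_pos_of_pos hε0 (t / 2)) (profile_pos_of_mem hεd)
  exact pos_of_mul_pos_right (h2.trans_le h1) (Real.rpow_pos_of_pos hx0 _).le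

theorem exists_robinParam_eq {N : ℕ} (hN : 1 ≤ N) {t : ℝ} (ht : 0 < t) :
    ∃ z ∈ profileDomain N, robinParam N z = t := by
  -- Where `H > 0`, `A` has the sign of `t` minus the Robin parameter. The solution sought is the
  -- first zero of `A`, up to which `H` stays positive.
  set A : ℝ → ℝ := fun z => t * profile N z + 2 * z * profileDeriv N z
  have hA : Continuous A := ((continuous_profile hN).const_mul t).add
    ((continuous_id.const_mul 2).mul (continuous_profileDeriv hN))
  have hA0 : 0 < A 0 := by simp [A, profile_zero, ht]
  by_cases hex : ∃ z, 0 < z ∧ A z ≤ 0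
  · obtain ⟨z₁, hz₁, hAz₁⟩ := hex
    set S := Icc 0 z₁ ∩ {z | A z ≤ 0}
    have hS : IsCompact S := isCompact_Icc.inter_right (isClosed_le hA continuous_const)
    obtain ⟨Z, hZS, hZmin⟩ := hS.exists_isLeast ⟨z₁, ⟨hz₁.le, le_rfl⟩, hAz₁⟩
    have hlt : ∀ z ∈ Ico 0 Z, 0 < A z := by
      intro z hz
      by_contra hcon
      exact absurd (hZmin ⟨⟨hz.1, hz.2.le.trans hZS.1.2⟩, not_lt.1 hcon⟩) (not_le.2 hz.2)
    have hZ0 : 0 < Z := by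
      refine lt_of_le_of_ne hZS.1.1 fun h => ?_
      have := hZS.2
      rw [← h] at this
      exact absurd hA0 (not_lt.2 this)
    have hAZ : A Z = 0 := by
      refine le_antisymm hZS.2 ?_
      refine ge_of_tendsto (hA.continuousAt.tendsto.mono_left (nhdsWithin_le_nhds (s := Iio Z))) ?_
      filter_upwards [Ioo_mem_nhdsLT hZ0] with z hz
      exact (hlt z ⟨hz.1.le, hz.2⟩).le
    have hdom := profile_pos_of_forall_Ico hN hZ0 hlt
    refine ⟨Z, hdom, ?_⟩
    have := profile_pos_of_mem hdom
    rw [robinParam, div_eq_iff this.ne']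
    simp only [A] at hAZ
    linarith
  · push Not at hex
    have hdom : ∀ z, 0 < z → z ∈ profileDomain N := fun z hz =>
      profile_pos_of_forall_Ico hN hz fun x hx => by
        rcases hx.1.eq_or_lt with h0 | h0
        · rw [← h0]; exact hA0
        · exact hex x h0
    have hφt : ∀ z, 0 < z → robinParam N z < t := fun z hz => by
      have h1 := hex z hz
      rw [robinParam, div_lt_iff₀ (profile_pos_of_mem (hdom z hz))]
      simp only [A] at h1
      linarith
    have hφ0 : ∀ z, 0 < z → 0 < robinParam N z := fun z hz => by
      refine lt_of_le_of_lt ?_ (strictMonoOn_robinParam hN (hdom (z / 2) (by positivity))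
        (hdom z hz) (by linarith))
      refine le_of_tendsto (tendsto_robinParam_zero hN) ?_
      filter_upwards [Ioo_mem_nhdsGT (show 0 < z / 2 by positivity)] with x hx
      exact (strictMonoOn_robinParam hN (hdom x hx.1) (hdom _ (by positivity)) hx.2).le
    exfalso
    -- If the parameter stayed below `t` forever, then for `z ≥ B` the linear term `(N - 2) φ` would
    -- be at most `z / 2`, so the Riccati equation would give `φ' ≥ 1 / 4`, contradicting
    -- boundedness.
    set B := 2 * N * t + 1
    have hB : 0 < B := by positivity
    have hmono : MonotoneOn (fun z => robinParam N z - z / 4) (Ici B) := by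
      have hd : ∀ z ∈ Ici B, HasDerivAt (fun z => robinParam N z - z / 4) _ z := fun z hz =>
        (hasDerivAt_robinParam hN (hdom z (hB.trans_le hz))).sub ((hasDerivAt_id z).div_const 4)
      refine monotoneOn_of_hasDerivWithinAt_nonneg (convex_Ici _)
        (fun z hz => (hd z hz).continuousAt.continuousWithinAt)
        (fun z hz => (hd z (interior_subset hz)).hasDerivWithinAt) fun z hz => ?_
      have hz : B ≤ z := interior_subset hz
      have hz0 : 0 < z := hB.trans_le hz
      have h1 := hφt z hz0
      have h0 := hφ0 z hz0
      have : z / 2 ≤ robinParamSlope N z := by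
        unfold robinParamSlope
        have : N * robinParam N z ≤ N * t := by gcongr
        nlinarith
      have h4 : (1 : ℝ) / 4 ≤ robinParamSlope N z / (2 * z) := by
        rw [le_div_iff₀ (by positivity)]; linarith
      linarith
    have h1 := hmono (mem_Ici.2 le_rfl) (mem_Ici.2 (by linarith : B ≤ B + 4 * t)) (by linarith)
    have h2 := hφ0 B hB
    have h3 := hφt (B + 4 * t) (by linarith)
    simp only at h1
    linarith

/-- The inverse of the Robin parameter: `robinParamInv N t / r²` is the fundamental eigenvalue
of the ball of radius `r` when the boundary parameter is `t / r`. -/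
def robinParamInv (N : ℕ) : ℝ → ℝ := Function.invFunOn (robinParam N) (profileDomain N)

theorem robinParamInv_mem {N : ℕ} (hN : 1 ≤ N) {t : ℝ} (ht : 0 < t) :
    robinParamInv N t ∈ profileDomain N :=
  Function.invFunOn_mem (exists_robinParam_eq hN ht)

theorem robinParam_robinParamInv {N : ℕ} (hN : 1 ≤ N) {t : ℝ} (ht : 0 < t) :
    robinParam N (robinParamInv N t) = t :=
  Function.invFunOn_eq (exists_robinParam_eq hN ht)

/-- The local inverse from the inverse function theorem takes values in the domain near `t`, where
injectivity identifies it with the global inverse. -/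
theorem hasDerivAt_robinParamInv {N : ℕ} (hN : 1 ≤ N) {t : ℝ} (ht : 0 < t) :
    HasDerivAt (robinParamInv N)
      (2 * robinParamInv N t / (robinParamInv N t - (N - 2) * t + t ^ 2)) t := by
  have hdom := isOpen_profileDomain hN
  set z := robinParamInv N t
  have hz : z ∈ profileDomain N := robinParamInv_mem hN ht
  have hzt : robinParam N z = t := robinParam_robinParamInv hN ht
  have hz0 : 0 < z := hz.1
  have hslope := robinParamSlope_pos hN z hz
  have hcont : ContinuousAt (fun z => robinParamSlope N z / (2 * z)) z := by
    have h1 := (hasDerivAt_robinParam hN hz).continuousAt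
    have h2 : ContinuousAt (robinParamSlope N) z :=
      (continuousAt_id.sub (h1.const_mul _)).add (h1.pow 2)
    exact h2.div (continuousAt_id.const_mul 2) (by positivity)
  have hstrict : HasStrictDerivAt (robinParam N) (robinParamSlope N z / (2 * z)) z :=
    hasStrictDerivAt_of_hasDerivAt_of_continuousAt
      (by filter_upwards [hdom.mem_nhds hz] with y hy using hasDerivAt_robinParam hN hy) hcont
  have hne : robinParamSlope N z / (2 * z) ≠ 0 := by positivity
  have hinv := hstrict.to_localInverse hne
  have hleft : hstrict.localInverse _ _ _ hne t = z := by
    have := (hstrict.hasStrictFDerivAt_equiv hne).localInverse_apply_image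
    rwa [hzt] at this
  rw [hzt] at hinv
  have hmem : ∀ᶠ s in 𝓝 t, hstrict.localInverse _ _ _ hne s ∈ profileDomain N :=
    hinv.hasDerivAt.continuousAt.eventually_mem (by rw [hleft]; exact hdom.mem_nhds hz)
  have hright : ∀ᶠ s in 𝓝 t, robinParam N (hstrict.localInverse _ _ _ hne s) = s := by
    have := (hstrict.hasStrictFDerivAt_equiv hne).eventually_right_inverse
    rwa [hzt] at this
  have heq : robinParamInv N =ᶠ[𝓝 t] hstrict.localInverse _ _ _ hne := by
    filter_upwards [hmem, hright, lt_mem_nhds ht] with s h1 h2 h3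
    exact (strictMonoOn_robinParam hN).injOn (robinParamInv_mem hN h3) h1
      ((robinParam_robinParamInv hN h3).trans h2.symm)
  refine (hinv.hasDerivAt.congr_of_eventuallyEq heq).congr_deriv ?_
  rw [robinParamSlope, hzt, inv_div]

theorem tendsto_robinParamInv_zero {N : ℕ} (hN : 1 ≤ N) :
    Tendsto (robinParamInv N) (𝓝[>] 0) (𝓝[>] 0) := by
  refine tendsto_nhdsWithin_iff.2 ⟨?_, ?_⟩
  · refine tendsto_order.2 ⟨fun a ha => ?_, fun a ha => ?_⟩
    · filter_upwards [self_mem_nhdsWithin] with t ht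
      exact ha.trans (robinParamInv_mem hN ht).1
    · obtain ⟨ε, hε, hε'⟩ := ((eventually_mem_profileDomain hN).and (Ioo_mem_nhdsGT ha)).exists
      have hφ : 0 < robinParam N ε := by
        have h2 : ε / 2 ∈ profileDomain N :=
          Ioc_subset_profileDomain hε ⟨by linarith [hε'.1], by linarith [hε'.1]⟩
        refine lt_of_le_of_lt ?_ (strictMonoOn_robinParam hN h2 hε (by linarith [hε'.1]))
        refine le_of_tendsto (tendsto_robinParam_zero hN) ?_
        filter_upwards [Ioo_mem_nhdsGT h2.1] with x hx
        exact (strictMonoOn_robinParam hN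
          (Ioc_subset_profileDomain h2 ⟨hx.1, hx.2.le⟩) h2 hx.2).le
      filter_upwards [Ioo_mem_nhdsGT hφ] with t ht
      refine lt_trans ?_ hε'.2
      rw [← (strictMonoOn_robinParam hN).lt_iff_lt (robinParamInv_mem hN ht.1) hε,
        robinParam_robinParamInv hN ht.1]
      exact ht.2
  · filter_upwards [self_mem_nhdsWithin] with t ht
    exact (robinParamInv_mem hN ht).1

theorem tendsto_robinParamInv_div {N : ℕ} (hN : 1 ≤ N) :
    Tendsto (fun t => robinParamInv N t / t) (𝓝[>] 0) (𝓝 N) := by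
  have hN' : (N : ℝ) ≠ 0 := by positivity
  have h := ((tendsto_robinParam_div hN).comp (tendsto_robinParamInv_zero hN)).inv₀
    (by positivity)
  rw [one_div, inv_inv] at h
  refine h.congr' ?_
  filter_upwards [self_mem_nhdsWithin] with t ht
  simp [robinParam_robinParamInv hN ht]

/-! ### The radial eigenvalue as a function of the radius -/

/-- The fundamental eigenvalue of the ball of radius `r` with boundary parameter `b`. -/
def radialEigenvalue (N : ℕ) (b r : ℝ) : ℝ := robinParamInv N (b * r) / r ^ 2

section radialEigenvalue

variable {N : ℕ} {b r : ℝ}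

theorem radialEigenvalue_mul_sq (hr : 0 < r) :
    radialEigenvalue N b r * r ^ 2 = robinParamInv N (b * r) := by
  rw [radialEigenvalue]; field_simp

theorem radialEigenvalue_pos (hN : 1 ≤ N) (hb : 0 < b) (hr : 0 < r) :
    0 < radialEigenvalue N b r :=
  div_pos (robinParamInv_mem hN (mul_pos hb hr)).1 (by positivity)

/-- Here `P + 1 = D / (b r)`, where `D > 0` is the Riccati slope at `z = L r²`. Logarithmic
differentiation of `L = z (b r) / r²` gives `r L' / L = 2 / (P + 1) - 2`. -/
theorem hasDerivAt_radialEigenvalue (hN : 1 ≤ N) (hb : 0 < b) (hr : 0 < r) {P : ℝ}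
    (hP : P = radialEigenvalue N b r * r / b + b * r - ((N : ℝ) - 1)) :
    0 < P + 1 ∧ HasDerivAt (radialEigenvalue N b)
      (-(2 * radialEigenvalue N b r / r) * (P / (P + 1))) r := by
  have hbr := mul_pos hb hr
  have hz := robinParamInv_mem hN hbr
  have hD := robinParamSlope_pos hN _ hz
  rw [robinParamSlope, robinParam_robinParamInv hN hbr, ← radialEigenvalue_mul_sq hr] at hD
  have hPD : P + 1 = (radialEigenvalue N b r * r ^ 2 - (N - 2) * (b * r) + (b * r) ^ 2) /
      (b * r) := by
    rw [hP]; field_simp; ring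
  have hP1 : 0 < P + 1 := by rw [hPD]; positivity
  refine ⟨hP1, ?_⟩
  have h1 : HasDerivAt (fun r => robinParamInv N (b * r)) _ r :=
    (hasDerivAt_robinParamInv hN hbr).comp r ((hasDerivAt_id r).const_mul b)
  have h : HasDerivAt (radialEigenvalue N b) _ r := h1.div (hasDerivAt_pow 2 r) (by positivity)
  refine h.congr_deriv ?_
  rw [← radialEigenvalue_mul_sq hr]
  have hP2 : P = (P + 1) - 1 := by ring
  rw [hP2, sub_add_cancel, hPD]
  generalize radialEigenvalue N b r * r ^ 2 - (N - 2) * (b * r) + (b * r) ^ 2 = D at hD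
  field_simp
  push_cast
  ring

theorem tendsto_radialEigenvalue_mul (hN : 1 ≤ N) (hb : 0 < b) :
    Tendsto (fun r => radialEigenvalue N b r * r) (𝓝[>] 0) (𝓝 (N * b)) := by
  have hbr : Tendsto (fun r => b * r) (𝓝[>] 0) (𝓝[>] 0) := by
    refine tendsto_nhdsWithin_iff.2 ⟨?_, ?_⟩
    · refine tendsto_nhdsWithin_of_tendsto_nhds ?_
      simpa using (tendsto_id (α := ℝ) (x := 𝓝 0)).const_mul b
    · filter_upwards [self_mem_nhdsWithin] with r (hr : 0 < r) using mul_pos hb hr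
  refine (((tendsto_robinParamInv_div hN).comp hbr).mul_const b).congr' ?_
  filter_upwards [self_mem_nhdsWithin] with r (hr : 0 < r)
  simp only [radialEigenvalue, Function.comp]
  field_simp

theorem profile_radialEigenvalue_pos (hN : 1 ≤ N) (hb : 0 < b) (hr : 0 < r) {ρ : ℝ}
    (hρ : ρ ∈ Icc 0 r) : 0 < profile N (radialEigenvalue N b r * ρ ^ 2) := by
  have hL := radialEigenvalue_pos hN hb hr
  refine (robinParamInv_mem hN (mul_pos hb hr)).2 _ ⟨by positivity, ?_⟩
  rw [← radialEigenvalue_mul_sq hr]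
  have := hρ.1
  have := hρ.2
  gcongr

theorem robinParam_radialEigenvalue (hN : 1 ≤ N) (hb : 0 < b) (hr : 0 < r) :
    robinParam N (radialEigenvalue N b r * r ^ 2) = b * r := by
  rw [radialEigenvalue_mul_sq hr, robinParam_robinParamInv hN (mul_pos hb hr)]

/-- The radial eigenvalue plus a multiple of the volume is strongly convex in the radius. -/
theorem exists_strongConvexOn_radialEigenvalue (hN : 2 ≤ N) (hb : 0 < b) {K : ℝ} (hK : 0 < K) :
    ∃ m : ℝ, 0 < m ∧
      StrongConvexOn (Ioi (0 : ℝ)) m (fun r => radialEigenvalue N b r + K * r ^ N) := by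
  have hN1 : 1 ≤ N := by omega
  have hcast : ((N - 1 : ℕ) : ℝ) = N - 1 := by push_cast [Nat.cast_sub hN1]; ring
  have h := exists_strongConvexOn (n := N - 1) (by omega) hb (L := radialEigenvalue N b) rfl
    (fun r hr => radialEigenvalue_pos hN1 hb hr)
    (fun r hr => (hasDerivAt_radialEigenvalue hN1 hb hr (by rw [hcast])).1)
    (fun r hr => (hasDerivAt_radialEigenvalue hN1 hb hr (by rw [hcast])).2)
    (by rw [hcast, sub_add_cancel]; exact tendsto_radialEigenvalue_mul hN1 hb) hK
  rwa [Nat.sub_add_cancel hN1] at h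

end radialEigenvalue

/-! ### Uniqueness of uniform measures on the sphere -/

section general

/-- A measure on `E` is carried by the unit sphere and all balls of the same radius centered on
the sphere have the same measure. -/
structure IsUniformOnSphere {E : Type*} [NormedAddCommGroup E] [MeasurableSpace E]
    (μ : Measure E) : Prop where
  compl_sphere : μ (sphere 0 1)ᶜ = 0
  closedBall_eq : ∀ x ∈ sphere (0 : E) 1, ∀ y ∈ sphere (0 : E) 1, ∀ ε : ℝ,
    μ (closedBall x ε) = μ (closedBall y ε)

theorem IsUniformOnSphere.add {E : Type*} [NormedAddCommGroup E]
    [MeasurableSpace E] {μ ν : Measure E} (hμ : IsUniformOnSphere μ)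
    (hν : IsUniformOnSphere ν) : IsUniformOnSphere (μ + ν) where
  compl_sphere := by simp [hμ.compl_sphere, hν.compl_sphere]
  closedBall_eq x hx y hy ε := by
    simp [hμ.closedBall_eq x hx y hy ε, hν.closedBall_eq x hx y hy ε]

variable {E : Type*} [NormedAddCommGroup E] [InnerProductSpace ℝ E]

theorem exists_linearIsometryEquiv_apply_eq {x y : E} (h : ‖x‖ = ‖y‖) :
    ∃ R : E ≃ₗᵢ[ℝ] E, R x = y :=
  ⟨(Submodule.span ℝ {x - y})ᗮ.reflection, Submodule.reflection_sub h⟩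

variable [MeasurableSpace E]

theorem isUniformOnSphere_of_map_eq {μ : Measure E} (h0 : μ (sphere 0 1)ᶜ = 0)
    (h : ∀ R : E ≃ₗᵢ[ℝ] E, ∀ x : E, ∀ ε : ℝ,
      μ (R '' (sphere 0 1 ∩ closedBall x ε)) = μ (sphere 0 1 ∩ closedBall x ε)) :
    IsUniformOnSphere μ where
  compl_sphere := h0
  closedBall_eq x hx y hy ε := by
    obtain ⟨R, rfl⟩ := exists_linearIsometryEquiv_apply_eq
      (show ‖x‖ = ‖y‖ by rw [mem_sphere_zero_iff_norm.1 hx, mem_sphere_zero_iff_norm.1 hy])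
    have key : ∀ s : Set E, μ s = μ (sphere 0 1 ∩ s) := fun s => by
      refine (measure_congr ?_).symm
      have : ∀ᵐ x ∂μ, x ∈ sphere (0 : E) 1 := h0
      filter_upwards [this] with x hx
      exact propext ⟨fun h => h.2, fun h => ⟨hx, h⟩⟩
    rw [key, key (closedBall (R x) ε), ← h R, image_inter R.injective, R.image_closedBall,
      R.image_sphere, map_zero]

variable [BorelSpace E] [FiniteDimensional ℝ E]

/-- By Besicovitch differentiation the density of `μ` is a limit of ratios of measures of small
balls. These ratios do not depend on the centre on the sphere, so the density is constant. -/
theorem IsUniformOnSphere.exists_eq_smul {μ κ : Measure E} [IsFiniteMeasure μ] [IsFiniteMeasure κ]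
    (hμ : IsUniformOnSphere μ) (hκ : IsUniformOnSphere κ) (hac : μ ≪ κ) :
    ∃ c : ℝ≥0∞, μ = c • κ := by
  rcases eq_or_ne κ 0 with rfl | hκ0
  · exact ⟨0, by rw [zero_smul]; exact Measure.absolutelyContinuous_zero_iff.1 hac⟩
  have h1 := Besicovitch.ae_tendsto_rnDeriv μ κ
  have h2 : ∀ᵐ x ∂κ, x ∈ sphere (0 : E) 1 := hκ.compl_sphere
  have : (ae κ).NeBot := ae_neBot.2 hκ0
  obtain ⟨x₀, hx₀, hx₀s⟩ := (h1.and h2).exists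
  refine ⟨μ.rnDeriv κ x₀, ?_⟩
  have h3 : μ.rnDeriv κ =ᵐ[κ] fun _ => μ.rnDeriv κ x₀ := by
    filter_upwards [h1, h2] with x hx hxs
    refine tendsto_nhds_unique hx (hx₀.congr fun ε => ?_)
    rw [hμ.closedBall_eq x hxs x₀ hx₀s, hκ.closedBall_eq x hxs x₀ hx₀s]
  conv_lhs => rw [← Measure.withDensity_rnDeriv_eq μ κ hac, withDensity_congr_ae h3,
    withDensity_const]

/-- Two nonzero finite uniform measures on the sphere are proportional. -/
theorem IsUniformOnSphere.exists_pos_eq_smul {μ ν : Measure E} [IsFiniteMeasure μ]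
    [IsFiniteMeasure ν] (hμ : IsUniformOnSphere μ) (hν : IsUniformOnSphere ν) (hμ0 : μ ≠ 0)
    (hν0 : ν ≠ 0) : ∃ c : ℝ, 0 < c ∧ μ = ENNReal.ofReal c • ν := by
  -- Comparing both measures with `μ + ν` supplies absolute continuity for free.
  obtain ⟨c, hc⟩ := hμ.exists_eq_smul (hμ.add hν) (Measure.AbsolutelyContinuous.rfl.add_right _)
  obtain ⟨d, hd⟩ := hν.exists_eq_smul (hμ.add hν)
    (by rw [add_comm]; exact Measure.AbsolutelyContinuous.rfl.add_right _)
  have hmu : (μ + ν) univ ≠ 0 := by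
    intro h
    exact hμ0 (Measure.measure_univ_eq_zero.1 (by simpa using (by simpa using h : _ ∧ _).1))
  have hc0 : c ≠ 0 := by rintro rfl; exact hμ0 (by rw [hc, zero_smul])
  have hd0 : d ≠ 0 := by rintro rfl; exact hν0 (by rw [hd, zero_smul])
  have hct : c ≠ ⊤ := by
    rintro rfl
    have := congrArg (fun m : Measure E => m univ) hc
    simp only [Measure.smul_apply, smul_eq_mul, ENNReal.top_mul hmu] at this
    exact measure_ne_top _ _ this
  have hdt : d ≠ ⊤ := by
    rintro rfl
    have := congrArg (fun m : Measure E => m univ) hd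
    simp only [Measure.smul_apply, smul_eq_mul, ENNReal.top_mul hmu] at this
    exact measure_ne_top _ _ this
  have hcd0 : c / d ≠ 0 := ENNReal.div_ne_zero.2 ⟨hc0, hdt⟩
  have hcdt : c / d ≠ ⊤ := ENNReal.div_ne_top hct hd0
  refine ⟨(c / d).toReal, ENNReal.toReal_pos hcd0 hcdt, ?_⟩
  rw [ENNReal.ofReal_toReal hcdt]
  conv_rhs => rw [hd]
  rw [smul_smul, ENNReal.div_mul_cancel hd0 hdt]
  exact hc

end general

/-! ### Hausdorff measure and cone measure on the sphere -/

section sphere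

variable {N : ℕ}

open scoped Pointwise

/-- The cone measure on the unit sphere, as a measure on the ambient space. -/
def coneMeasure (N : ℕ) : Measure (EuclideanSpace ℝ (Fin N)) :=
  ((volume : Measure (EuclideanSpace ℝ (Fin N))).toSphere).map Subtype.val

instance : IsFiniteMeasure (coneMeasure N) := by unfold coneMeasure; infer_instance

theorem coneMeasure_apply {s : Set (EuclideanSpace ℝ (Fin N))} (hs : MeasurableSet s) :
    coneMeasure N s = N * volume (Ioo (0 : ℝ) 1 • (sphere 0 1 ∩ s)) := by
  rw [coneMeasure, Measure.map_apply measurable_subtype_coe hs,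
    Measure.toSphere_apply' _ (measurable_subtype_coe hs), Subtype.image_preimage_coe,
    finrank_euclideanSpace_fin]

theorem isUniformOnSphere_coneMeasure : IsUniformOnSphere (coneMeasure N) := by
  refine isUniformOnSphere_of_map_eq ?_ fun R x ε => ?_
  · rw [coneMeasure_apply isClosed_sphere.measurableSet.compl]; simp
  · have hK : IsCompact (sphere (0 : EuclideanSpace ℝ (Fin N)) 1 ∩ closedBall x ε) :=
      (isCompact_sphere 0 1).inter_right isClosed_closedBall
    rw [coneMeasure_apply (hK.image R.continuous).measurableSet,
      coneMeasure_apply hK.measurableSet]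
    have h1 : sphere (0 : EuclideanSpace ℝ (Fin N)) 1 ∩ R '' (sphere 0 1 ∩ closedBall x ε) =
        R '' (sphere 0 1 ∩ closedBall x ε) := by
      refine inter_eq_right.2 ?_
      rintro _ ⟨y, hy, rfl⟩
      simpa using hy.1
    have h2 : Ioo (0 : ℝ) 1 • (R '' (sphere 0 1 ∩ closedBall x ε)) =
        R '' (Ioo (0 : ℝ) 1 • (sphere 0 1 ∩ closedBall x ε)) := by
      ext z
      simp only [Set.mem_smul, mem_image]
      constructor
      · rintro ⟨t, ht, _, ⟨y, hy, rfl⟩, rfl⟩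
        exact ⟨t • y, ⟨t, ht, y, hy, rfl⟩, by simp⟩
      · rintro ⟨_, ⟨t, ht, y, hy, rfl⟩, rfl⟩
        exact ⟨t, ht, R y, ⟨y, hy, rfl⟩, by simp⟩
    rw [h1, h2, ← inter_assoc, inter_self, R.image_eq_preimage_symm,
      R.symm.measurePreserving.measure_preimage_emb R.symm.toHomeomorph.measurableEmbedding]

theorem coneMeasure_ne_zero (hN : 1 ≤ N) : coneMeasure N ≠ 0 := by
  have : NeZero N := ⟨by omega⟩
  have : Nontrivial (EuclideanSpace ℝ (Fin N)) := inferInstance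
  intro h
  rw [coneMeasure, Measure.map_eq_zero_iff measurable_subtype_coe.aemeasurable] at h
  exact Measure.toSphere_ne_zero _ h

/-- The surface measure on the unit sphere. -/
def unitSphereMeasure (N : ℕ) : Measure (EuclideanSpace ℝ (Fin N)) :=
  (μHE[N - 1] : Measure (EuclideanSpace ℝ (Fin N))).restrict (sphere 0 1)

theorem isUniformOnSphere_unitSphereMeasure : IsUniformOnSphere (unitSphereMeasure N) := by
  refine isUniformOnSphere_of_map_eq ?_ fun R x ε => ?_
  · rw [unitSphereMeasure, Measure.restrict_apply isClosed_sphere.measurableSet.compl]; simp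
  · have hK : IsCompact (sphere (0 : EuclideanSpace ℝ (Fin N)) 1 ∩ closedBall x ε) :=
      (isCompact_sphere 0 1).inter_right isClosed_closedBall
    have h1 : R '' (sphere 0 1 ∩ closedBall x ε) ∩ sphere (0 : EuclideanSpace ℝ (Fin N)) 1 =
        R '' (sphere 0 1 ∩ closedBall x ε) := by
      refine inter_eq_left.2 ?_
      rintro _ ⟨y, hy, rfl⟩
      simpa using hy.1
    rw [unitSphereMeasure, Measure.restrict_apply (hK.image R.continuous).measurableSet,
      Measure.restrict_apply hK.measurableSet, h1, R.isometry.euclideanHausdorffMeasure_image,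
      inter_right_comm, inter_self]

theorem _root_.LipschitzOnWith.euclideanHausdorffMeasure_image_le {X Y : Type*} [EMetricSpace X]
    [MeasurableSpace X] [BorelSpace X] [EMetricSpace Y] [MeasurableSpace Y] [BorelSpace Y]
    {K : NNReal} {f : X → Y} {s : Set X} (h : LipschitzOnWith K f s) (d : ℕ) :
    μHE[d] (f '' s) ≤ (K : ℝ≥0∞) ^ d * μHE[d] s := by
  rw [Measure.euclideanHausdorffMeasure_def, Measure.euclideanHausdorffMeasure_def,
    Measure.smul_apply, Measure.smul_apply, ENNReal.smul_def, ENNReal.smul_def, smul_eq_mul,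
    smul_eq_mul, mul_left_comm]
  have := h.hausdorffMeasure_image_le (d := d) (by positivity)
  rw [ENNReal.rpow_natCast] at this
  gcongr

theorem finrank_orthogonal_span_singleton' (hN : 1 ≤ N) {v : EuclideanSpace ℝ (Fin N)}
    (hv : ‖v‖ = 1) :
    Module.finrank ℝ (Submodule.span ℝ {v})ᗮ = N - 1 := by
  have : Fact (Module.finrank ℝ (EuclideanSpace ℝ (Fin N)) = (N - 1) + 1) :=
    ⟨by rw [finrank_euclideanSpace_fin]; omega⟩
  exact Submodule.finrank_orthogonal_span_singleton (by rintro rfl; simp at hv)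

/-- Stereographic projection from `v` sends this hemisphere into a ball of radius `2` in the
hyperplane `v^⊥`. Its inverse is `C¹`, hence Lipschitz on that ball, where the Hausdorff measure is
Lebesgue measure. -/
theorem hausdorff_hemisphere_lt_top (hN : 1 ≤ N) {v : EuclideanSpace ℝ (Fin N)} (hv : ‖v‖ = 1) :
    (μHE[N - 1] : Measure (EuclideanSpace ℝ (Fin N)))
      (sphere 0 1 ∩ {x | inner ℝ v x ≤ 0}) < ⊤ := by
  set V := (Submodule.span ℝ {v})ᗮ
  have hsub : sphere 0 1 ∩ {x | inner ℝ v x ≤ 0} ⊆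
      (fun w : V => stereoInvFunAux v (w : EuclideanSpace ℝ (Fin N))) '' closedBall 0 2 := by
    rintro x ⟨hx, hvx⟩
    have hxv : x ≠ v := by
      rintro rfl
      simp [hv] at hvx
      linarith
    refine ⟨stereoToFun v x, ?_, ?_⟩
    · rw [mem_closedBall_zero_iff, stereoToFun_apply, norm_smul]
      have h1 : ‖V.orthogonalProjectionOnto x‖ ≤ 1 :=
        (V.norm_orthogonalProjectionOnto_apply_le x).trans (mem_sphere_zero_iff_norm.1 hx).le
      have h2 : ‖2 / (1 - innerSL ℝ v x)‖ ≤ 2 := by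
        rw [innerSL_apply_apply, Real.norm_eq_abs, abs_of_nonneg (by
          have : inner ℝ v x ≤ 0 := hvx
          exact div_nonneg zero_le_two (by linarith))]
        have : inner ℝ v x ≤ 0 := hvx
        rw [div_le_iff₀ (by linarith)]
        linarith
      calc _ ≤ (2 : ℝ) * 1 := mul_le_mul h2 h1 (norm_nonneg _) zero_le_two
        _ = 2 := by norm_num
    · exact congrArg Subtype.val (stereo_left_inv hv (x := ⟨x, hx⟩) hxv)
  have hcd : ContDiff ℝ 1 (fun w : V => stereoInvFunAux v (w : EuclideanSpace ℝ (Fin N))) :=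
    contDiff_stereoInvFunAux.comp V.subtypeL.contDiff
  obtain ⟨K, hK⟩ := hcd.contDiffOn.exists_lipschitzOnWith one_ne_zero (convex_closedBall (0 : V) 2)
    (isCompact_closedBall 0 2)
  refine (measure_mono hsub).trans_lt ((hK.euclideanHausdorffMeasure_image_le _).trans_lt ?_)
  have h3 : (μHE[N - 1] : Measure V) = volume := by
    rw [← finrank_orthogonal_span_singleton' hN hv]
    exact InnerProductSpace.euclideanHausdorffMeasure_eq_volume
  rw [h3]
  exact ENNReal.mul_lt_top (ENNReal.pow_lt_top ENNReal.coe_lt_top) measure_closedBall_lt_top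

theorem hausdorff_sphere_lt_top (hN : 1 ≤ N) :
    (μHE[N - 1] : Measure (EuclideanSpace ℝ (Fin N))) (sphere 0 1) < ⊤ := by
  have : NeZero N := ⟨by omega⟩
  obtain ⟨v, hv⟩ := exists_norm_eq (EuclideanSpace ℝ (Fin N)) zero_le_one
  refine (measure_mono (t := (sphere 0 1 ∩ {x | inner ℝ v x ≤ 0}) ∪
    (sphere 0 1 ∩ {x | inner ℝ (-v) x ≤ 0})) fun x hx => ?_).trans_lt ?_
  · rcases le_total (inner ℝ v x) 0 with h | h
    · exact Or.inl ⟨hx, h⟩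
    · exact Or.inr ⟨hx, by simpa [inner_neg_left] using h⟩
  · exact (measure_union_le _ _).trans_lt (ENNReal.add_lt_top.2
      ⟨hausdorff_hemisphere_lt_top hN hv, hausdorff_hemisphere_lt_top hN (by rwa [norm_neg])⟩)

/-- Orthogonal projection to a hyperplane is `1`-Lipschitz and maps the sphere onto a set containing
the unit ball, which has positive Lebesgue measure. -/
theorem hausdorff_sphere_ne_zero (hN : 1 ≤ N) :
    (μHE[N - 1] : Measure (EuclideanSpace ℝ (Fin N))) (sphere 0 1) ≠ 0 := by
  have : NeZero N := ⟨by omega⟩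
  obtain ⟨v, hv⟩ := exists_norm_eq (EuclideanSpace ℝ (Fin N)) zero_le_one
  set V := (Submodule.span ℝ {v})ᗮ
  have h3 : (μHE[N - 1] : Measure V) = volume := by
    rw [← finrank_orthogonal_span_singleton' hN hv]
    exact InnerProductSpace.euclideanHausdorffMeasure_eq_volume
  have hsub : ball (0 : V) 1 ⊆ V.orthogonalProjectionOnto '' sphere 0 1 := by
    intro w hw
    have hw1 : ‖(w : EuclideanSpace ℝ (Fin N))‖ < 1 := by simpa using hw
    have hwv : inner ℝ (w : EuclideanSpace ℝ (Fin N)) v = 0 :=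
      Submodule.mem_orthogonal_singleton_iff_inner_left.1 w.2
    refine ⟨w + √(1 - ‖(w : EuclideanSpace ℝ (Fin N))‖ ^ 2) • v, ?_, ?_⟩
    · have h4 : 0 ≤ 1 - ‖(w : EuclideanSpace ℝ (Fin N))‖ ^ 2 := by
        nlinarith [norm_nonneg (w : EuclideanSpace ℝ (Fin N))]
      rw [mem_sphere_zero_iff_norm, ← sq_eq_sq₀ (norm_nonneg _) zero_le_one, norm_add_sq_real,
        inner_smul_right, hwv, norm_smul, hv, Real.norm_eq_abs, mul_one, sq_abs, Real.sq_sqrt h4]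
      ring
    · have h5 : V.orthogonalProjectionOnto v = 0 := by
        rw [Submodule.orthogonalProjectionOnto_eq_zero_iff]
        exact Submodule.le_orthogonal_orthogonal _ (Submodule.mem_span_singleton_self v)
      rw [map_add, map_smul, h5, smul_zero, add_zero,
        Submodule.orthogonalProjectionOnto_mem_subspace_eq_self]
  intro h0
  have hlip : LipschitzOnWith 1 V.orthogonalProjectionOnto (sphere 0 1) :=
    (LipschitzWith.of_dist_le_mul fun x y => by
      rw [dist_eq_norm, dist_eq_norm, ← map_sub, NNReal.coe_one, one_mul]
      exact V.norm_orthogonalProjectionOnto_apply_le _).lipschitzOnWith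
  have h6 := (measure_mono hsub).trans (hlip.euclideanHausdorffMeasure_image_le (N - 1))
  rw [h0, mul_zero, h3] at h6
  exact (measure_ball_pos volume (0 : V) one_pos).ne' (le_antisymm h6 zero_le)

/-- The surface measure on the unit sphere is a positive multiple of the cone measure. -/
theorem exists_unitSphereMeasure_eq (hN : 1 ≤ N) :
    ∃ c : ℝ, 0 < c ∧ unitSphereMeasure N = ENNReal.ofReal c • coneMeasure N := by
  have : IsFiniteMeasure (unitSphereMeasure N) :=
    ⟨by simpa [unitSphereMeasure] using hausdorff_sphere_lt_top hN⟩
  refine isUniformOnSphere_unitSphereMeasure.exists_pos_eq_smul isUniformOnSphere_coneMeasure ?_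
    (coneMeasure_ne_zero hN)
  rw [unitSphereMeasure, Ne, Measure.restrict_eq_zero]
  exact hausdorff_sphere_ne_zero hN

theorem boundaryMeasure_ball {r : ℝ} (hr : 0 < r) :
    boundaryMeasure (ball (0 : EuclideanSpace ℝ (Fin N)) r) =
      ENNReal.ofReal (r ^ (N - 1)) • (unitSphereMeasure N).map (fun x => r • x) := by
  have hm : Measurable fun x : EuclideanSpace ℝ (Fin N) => r • x := measurable_const_smul r
  ext s hs
  rw [boundaryMeasure, frontier_ball _ hr.ne', Measure.restrict_apply hs, Measure.smul_apply,
    Measure.map_apply hm hs, unitSphereMeasure, Measure.restrict_apply (hm hs)]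
  have : s ∩ sphere 0 r = r • (((fun x => r • x) ⁻¹' s) ∩ sphere 0 1) := by
    ext x
    rw [mem_smul_set_iff_inv_smul_mem₀ hr.ne']
    simp only [mem_inter_iff, mem_preimage, smul_inv_smul₀ hr.ne', mem_sphere_zero_iff_norm,
      norm_smul, norm_inv, Real.norm_eq_abs, abs_of_pos hr]
    rw [inv_mul_eq_one₀ hr.ne', eq_comm (a := r)]
  rw [this, Measure.euclideanHausdorffMeasure_smul₀ _ hr.ne', ENNReal.smul_def, smul_eq_mul,
    smul_eq_mul]
  congr 1
  rw [ENNReal.coe_pow, ENNReal.ofReal_pow hr.le]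
  congr 1
  rw [← ENNReal.ofReal_coe_nnreal]
  simp [abs_of_pos hr]

theorem integral_boundaryMeasure_ball {c r : ℝ} (hc : 0 < c) (hr : 0 < r)
    (h : unitSphereMeasure N = ENNReal.ofReal c • coneMeasure N)
    {g : EuclideanSpace ℝ (Fin N) → ℝ} (hg : Continuous g) :
    ∫ x, g x ∂boundaryMeasure (ball 0 r) = c * r ^ (N - 1) *
      ∫ u : sphere (0 : EuclideanSpace ℝ (Fin N)) 1, g (r • (u : EuclideanSpace ℝ (Fin N)))
        ∂(volume : Measure (EuclideanSpace ℝ (Fin N))).toSphere := by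
  have hm : Measurable fun x : EuclideanSpace ℝ (Fin N) => r • x := measurable_const_smul r
  rw [boundaryMeasure_ball hr, h, integral_smul_measure,
    integral_map hm.aemeasurable hg.aestronglyMeasurable, integral_smul_measure, coneMeasure,
    integral_map measurable_subtype_coe.aemeasurable (show Continuous fun x :
      EuclideanSpace ℝ (Fin N) => g (r • x) by fun_prop).aestronglyMeasurable,
    ENNReal.toReal_ofReal hc.le, ENNReal.toReal_ofReal (by positivity), smul_eq_mul, smul_eq_mul]
  ring

theorem isFiniteMeasure_boundaryMeasure_ball (hN : 1 ≤ N) {r : ℝ} (hr : 0 < r) :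
    IsFiniteMeasure (boundaryMeasure (ball (0 : EuclideanSpace ℝ (Fin N)) r)) := by
  have : IsFiniteMeasure (unitSphereMeasure N) :=
    ⟨by simpa [unitSphereMeasure] using hausdorff_sphere_lt_top hN⟩
  rw [boundaryMeasure_ball hr]
  exact Measure.smul_finite _ ENNReal.ofReal_ne_top

end sphere

/-! ### Polar coordinates -/

/-- Polar coordinates in a ball, for continuous functions. -/
theorem setIntegral_ball_eq_integral_sphere {E : Type*} [NormedAddCommGroup E] [NormedSpace ℝ E]
    [Nontrivial E] [FiniteDimensional ℝ E] [MeasurableSpace E] [BorelSpace E] (μ : Measure E)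
    [μ.IsAddHaarMeasure] {r : ℝ} (hr : 0 < r) {F : E → ℝ} (hF : Continuous F) :
    ∫ x in ball 0 r, F x ∂μ = ∫ u : sphere (0 : E) 1,
      (∫ ρ in (0 : ℝ)..r, ρ ^ (Module.finrank ℝ E - 1) * F (ρ • (u : E))) ∂μ.toSphere := by
  set f : E → ℝ := (ball 0 r).indicator F
  have hfi : Integrable f μ := by
    rw [integrable_indicator_iff measurableSet_ball]
    exact (hF.continuousOn.integrableOn_compact (isCompact_closedBall 0 r)).mono_set
      ball_subset_closedBall
  have hmp := μ.measurePreserving_homeomorphUnitSphereProd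
  have hemb := (homeomorphUnitSphereProd E).measurableEmbedding
  set g : sphere (0 : E) 1 × Ioi (0 : ℝ) → ℝ := fun p => f (p.2.1 • p.1.1)
  have hg : ∀ x : ({0}ᶜ : Set E), g (homeomorphUnitSphereProd E x) = f x := fun x => by
    have hx : ‖(x : E)‖ ≠ 0 := norm_ne_zero_iff.2 x.2
    simp only [g, homeomorphUnitSphereProd_apply_snd_coe, homeomorphUnitSphereProd_apply_fst_coe,
      smul_inv_smul₀ hx]
  have hgi : Integrable g (μ.toSphere.prod (Measure.volumeIoiPow (Module.finrank ℝ E - 1))) := by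
    rw [← hmp.integrable_comp_emb hemb]
    have : g ∘ homeomorphUnitSphereProd E = f ∘ Subtype.val := funext hg
    rw [this, ← integrableOn_iff_comap_subtypeVal (measurableSet_singleton _).compl]
    exact hfi.integrableOn
  calc ∫ x in ball 0 r, F x ∂μ = ∫ x, f x ∂μ := (integral_indicator measurableSet_ball).symm
    _ = ∫ x : ({0}ᶜ : Set E), f x ∂(μ.comap (↑)) := by
      rw [integral_subtype_comap (measurableSet_singleton _).compl fun x ↦ f x,
        restrict_compl_singleton]
    _ = ∫ p, g p ∂(μ.toSphere.prod (Measure.volumeIoiPow (Module.finrank ℝ E - 1))) := by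
      rw [← hmp.integral_comp hemb]
      exact integral_congr_ae (Eventually.of_forall fun x => (hg x).symm)
    _ = _ := integral_prod _ hgi
    _ = _ := by
      refine integral_congr_ae (Eventually.of_forall fun u => ?_)
      have hu : ‖(u : E)‖ = 1 := mem_sphere_zero_iff_norm.1 u.2
      simp only [Measure.volumeIoiPow, g]
      rw [integral_withDensity_eq_integral_toReal_smul (by fun_prop)
        (Eventually.of_forall fun _ => ENNReal.ofReal_lt_top),
        integral_subtype_comap measurableSet_Ioi fun a : ℝ =>
          (ENNReal.ofReal (a ^ (Module.finrank ℝ E - 1))).toReal • f (a • (u : E)),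
        intervalIntegral.integral_of_le hr.le, integral_Ioc_eq_integral_Ioo, ← Ioi_inter_Iio,
        ← setIntegral_indicator measurableSet_Iio]
      refine setIntegral_congr_fun measurableSet_Ioi fun ρ (hρ : 0 < ρ) => ?_
      simp only [f]
      rw [ENNReal.toReal_ofReal (by positivity), smul_eq_mul]
      have hn : ‖ρ • (u : E)‖ = ρ := by rw [norm_smul, hu, mul_one, Real.norm_of_nonneg hρ.le]
      by_cases h : ρ < r
      · rw [indicator_of_mem (by rwa [mem_ball_zero_iff, hn]), indicator_of_mem (mem_Iio.2 h)]
      · rw [indicator_of_notMem (by rwa [mem_ball_zero_iff, hn]),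
          indicator_of_notMem (by rwa [mem_Iio]), mul_zero]

/-! ### The energy identity on a ray -/

section ray

variable {N : ℕ} {L r b : ℝ}

/-- The negative logarithmic derivative of the radial function `ρ ↦ H (L ρ²)`. -/
def negLogDeriv (N : ℕ) (L ρ : ℝ) : ℝ :=
  -(2 * L * ρ * profileDeriv N (L * ρ ^ 2)) / profile N (L * ρ ^ 2)

/-- This is the Riccati equation of `y = -u'/u` in divergence form; it turns the energy on a ray
into a complete square. -/
theorem hasDerivAt_pow_mul_negLogDeriv (hN : 2 ≤ N) {ρ : ℝ} (hH : 0 < profile N (L * ρ ^ 2)) :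
    HasDerivAt (fun ρ => ρ ^ (N - 1) * negLogDeriv N L ρ)
      (ρ ^ (N - 1) * (L + negLogDeriv N L ρ ^ 2)) ρ := by
  have hN1 : 1 ≤ N := by omega
  obtain ⟨n, rfl⟩ : ∃ n, N = n + 2 := ⟨N - 2, by omega⟩
  have hsq : HasDerivAt (fun ρ : ℝ => L * ρ ^ 2) (L * (2 * ρ)) ρ := by
    simpa using (hasDerivAt_pow 2 ρ).const_mul L
  have h1 := (hasDerivAt_profile hN1 (L * ρ ^ 2)).comp ρ hsq
  have h2 := (hasDerivAt_profileDeriv hN1 (L * ρ ^ 2)).comp ρ hsq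
  have h : HasDerivAt (fun ρ => ρ ^ (n + 2 - 1) * negLogDeriv (n + 2) L ρ) _ ρ :=
    (hasDerivAt_pow (n + 2 - 1) ρ).mul
      (((((hasDerivAt_id ρ).const_mul (2 * L)).mul h2).neg).div h1 hH.ne')
  refine h.congr_deriv ?_
  have ode := profile_ode hN1 (L * ρ ^ 2)
  have e1 : n + 2 - 1 = n + 1 := by omega
  have e2 : n + 1 - 1 = n := by omega
  simp only [negLogDeriv, id, Pi.mul_apply, Pi.neg_apply, Function.comp_apply, e1, e2]
  push_cast at ode ⊢
  generalize profile (n + 2) (L * ρ ^ 2) = H at *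
  generalize profileDeriv (n + 2) (L * ρ ^ 2) = H' at *
  generalize profileDeriv₂ (n + 2) (L * ρ ^ 2) = H'' at *
  field_simp
  linear_combination (-L * H * ρ ^ (n + 1)) * ode

theorem continuousOn_negLogDeriv (hN : 1 ≤ N)
    (hH : ∀ ρ ∈ Icc 0 r, 0 < profile N (L * ρ ^ 2)) :
    ContinuousOn (negLogDeriv N L) (Icc 0 r) := by
  have h1 := continuous_profile hN
  have h2 := continuous_profileDeriv hN
  refine ContinuousOn.div (by fun_prop) (by fun_prop) fun ρ hρ => (hH ρ hρ).ne'

/-- The energy identity along a ray. -/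
theorem ray_energy_eq (hN : 2 ≤ N) (hr : 0 < r)
    (hH : ∀ ρ ∈ Icc 0 r, 0 < profile N (L * ρ ^ 2)) (hb : negLogDeriv N L r = b)
    {w w' : ℝ → ℝ} (hw : ∀ ρ, HasDerivAt w (w' ρ) ρ) (hw' : Continuous w') :
    (∫ ρ in (0 : ℝ)..r, ρ ^ (N - 1) * (w' ρ ^ 2 - L * w ρ ^ 2)) + b * r ^ (N - 1) * w r ^ 2 =
      ∫ ρ in (0 : ℝ)..r, ρ ^ (N - 1) * (w' ρ + negLogDeriv N L ρ * w ρ) ^ 2 := by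
  have hwc : Continuous w := continuous_iff_continuousAt.2 fun x => (hw x).continuousAt
  have hy := continuousOn_negLogDeriv (by omega : 1 ≤ N) hH
  rw [← uIcc_of_le hr.le] at hy
  -- The two sides of the identity differ by the integral of the derivative of `ρ ^ (N - 1) y w²`.
  -- Its value at `r` is the Robin term, and at `0` it vanishes because `N ≥ 2`.
  have hd : ∀ ρ ∈ uIcc 0 r, HasDerivAt (fun ρ => ρ ^ (N - 1) * negLogDeriv N L ρ * w ρ ^ 2)
      (ρ ^ (N - 1) * (L + negLogDeriv N L ρ ^ 2) * w ρ ^ 2 +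
        ρ ^ (N - 1) * negLogDeriv N L ρ * (2 * w ρ * w' ρ)) ρ := fun ρ hρ => by
    rw [uIcc_of_le hr.le] at hρ
    have h : HasDerivAt (fun ρ => ρ ^ (N - 1) * negLogDeriv N L ρ * w ρ ^ 2) _ ρ :=
      (hasDerivAt_pow_mul_negLogDeriv hN (hH ρ hρ)).mul ((hw ρ).pow 2)
    refine h.congr_deriv ?_
    simp
  have hint : IntervalIntegrable (fun ρ => ρ ^ (N - 1) * (L + negLogDeriv N L ρ ^ 2) * w ρ ^ 2 +
      ρ ^ (N - 1) * negLogDeriv N L ρ * (2 * w ρ * w' ρ)) volume 0 r :=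
    ContinuousOn.intervalIntegrable (by fun_prop)
  have hint₂ : IntervalIntegrable (fun ρ => ρ ^ (N - 1) * (w' ρ ^ 2 - L * w ρ ^ 2)) volume 0 r :=
    ContinuousOn.intervalIntegrable (by fun_prop)
  have hftc := intervalIntegral.integral_eq_sub_of_hasDerivAt hd hint
  have h0 : (0 : ℝ) ^ (N - 1) = 0 := zero_pow (by omega)
  rw [hb, h0, zero_mul, zero_mul, sub_zero] at hftc
  rw [mul_comm b, ← hftc, ← intervalIntegral.integral_add hint₂ hint]
  refine intervalIntegral.integral_congr fun ρ _ => ?_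
  ring

end ray

/-! ### Square-integrable limits and weak gradients -/

theorem memLp_of_continuous_of_isCompact {X F : Type*} [TopologicalSpace X] [MeasurableSpace X]
    [OpensMeasurableSpace X] [SecondCountableTopology X] [NormedAddCommGroup F] {μ : Measure X}
    [IsFiniteMeasure μ] {K : Set X} (hK : IsCompact K) (hμ : ∀ᵐ x ∂μ, x ∈ K) {f : X → F}
    (hf : Continuous f) (p : ℝ≥0∞) : MemLp f p μ := by
  obtain ⟨C, hC⟩ := hK.exists_bound_of_continuousOn hf.continuousOn
  refine MemLp.of_bound hf.aestronglyMeasurable C ?_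
  filter_upwards [hμ] with x hx using hC x hx

theorem integral_norm_sq_eq_eLpNorm {X F : Type*} [MeasurableSpace X] [NormedAddCommGroup F]
    {μ : Measure X} {f : X → F} (hf : MemLp f 2 μ) :
    ∫ x, ‖f x‖ ^ 2 ∂μ = (eLpNorm f 2 μ).toReal ^ 2 := by
  have h := hf.eLpNorm_eq_integral_rpow_norm two_ne_zero ENNReal.ofNat_ne_top
  have h0 : 0 ≤ ∫ x, ‖f x‖ ^ 2 ∂μ := integral_nonneg fun x => by positivity
  simp only [ENNReal.toReal_ofNat, Real.rpow_ofNat] at h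
  rw [h, ENNReal.toReal_ofReal (by positivity), ← Real.rpow_natCast, ← Real.rpow_mul h0]
  norm_num

theorem tendsto_integral_norm_sq {X F : Type*} [MeasurableSpace X] [NormedAddCommGroup F]
    {μ : Measure X} {f : ℕ → X → F} {g : X → F} (hf : ∀ n, MemLp (f n) 2 μ) (hg : MemLp g 2 μ)
    (h : Tendsto (fun n => eLpNorm (fun x => f n x - g x) 2 μ) atTop (𝓝 0)) :
    Tendsto (fun n => ∫ x, ‖f n x‖ ^ 2 ∂μ) atTop (𝓝 (∫ x, ‖g x‖ ^ 2 ∂μ)) := by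
  have h1 := (Lp.tendsto_Lp_iff_tendsto_eLpNorm'' f hf g hg).2 h
  have h2 := (continuous_norm.tendsto _).comp h1
  simp only [Function.comp_def, Lp.norm_toLp] at h2
  rw [integral_norm_sq_eq_eLpNorm hg]
  simp only [fun n => integral_norm_sq_eq_eLpNorm (hf n)]
  exact h2.pow 2

theorem continuous_gradient {E : Type*} [NormedAddCommGroup E] [InnerProductSpace ℝ E]
    [CompleteSpace E] {f : E → ℝ} (hf : ContDiff ℝ 1 f) : Continuous (∇ f) :=
  (InnerProductSpace.toDual ℝ E).symm.continuous.comp (hf.continuous_fderiv one_ne_zero)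

theorem inner_gradient {E : Type*} [NormedAddCommGroup E] [InnerProductSpace ℝ E]
    [CompleteSpace E] (f : E → ℝ) (x v : E) : inner ℝ (∇ f x) v = fderiv ℝ f x v := by
  simp [gradient]

/-- Pairing with a fixed vector `e` reduces the claim to scalar integration by parts on the whole
space, since the test function and its gradient vanish off `Ω`. -/
theorem isWeakGradient_gradient {N : ℕ} (Ω : Set (EuclideanSpace ℝ (Fin N)))
    {v : EuclideanSpace ℝ (Fin N) → ℝ} (hv : ContDiff ℝ 1 v) : IsWeakGradient Ω v (∇ v) := by
  intro φ hφ hφc hφΩ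
  have hφ1 : ContDiff ℝ 1 φ := hφ.of_le (by exact_mod_cast le_top)
  have hgc : HasCompactSupport (∇ φ) := by
    refine hφc.mono' ?_
    intro x hx
    by_contra hcon
    refine hx ?_
    have : fderiv ℝ φ x = 0 := by
      by_contra h
      exact hcon (support_fderiv_subset ℝ h)
    simp [gradient, this]
  have hφ0 : ∀ x, x ∉ Ω → φ x = 0 := fun x hx => image_eq_zero_of_notMem_tsupport fun h => hx (hφΩ h)
  have hg0 : ∀ x, x ∉ Ω → ∇ φ x = 0 := fun x hx => by
    have : fderiv ℝ φ x = 0 := by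
      by_contra h
      exact hx (hφΩ (support_fderiv_subset ℝ h))
    simp [gradient, this]
  rw [setIntegral_eq_integral_of_forall_compl_eq_zero (fun x hx => by rw [hg0 x hx, smul_zero]),
    setIntegral_eq_integral_of_forall_compl_eq_zero (fun x hx => by rw [hφ0 x hx, zero_smul])]
  have hi1 : Integrable fun x => v x • ∇ φ x :=
    (hv.continuous.smul (continuous_gradient hφ1)).integrable_of_hasCompactSupport hgc.smul_left
  have hi2 : Integrable fun x => φ x • ∇ v x :=
    (hφ.continuous.smul (continuous_gradient hv)).integrable_of_hasCompactSupport hφc.smul_right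
  refine ext_inner_left ℝ fun e => ?_
  rw [inner_neg_right, ← integral_inner hi1, ← integral_inner hi2]
  have hin : ∀ (f : EuclideanSpace ℝ (Fin N) → ℝ) x, inner ℝ e (∇ f x) = fderiv ℝ f x e :=
    fun f x => by rw [real_inner_comm, inner_gradient]
  simp only [inner_smul_right, hin]
  have hvd : Continuous fun x => fderiv ℝ v x e :=
    (hv.continuous_fderiv one_ne_zero).clm_apply continuous_const
  have hφd : Continuous fun x => fderiv ℝ φ x e :=
    (hφ1.continuous_fderiv one_ne_zero).clm_apply continuous_const
  have key := integral_mul_fderiv_eq_neg_fderiv_mul_of_integrable (μ := volume) (f := v) (g := φ)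
    (v := e) ((hvd.mul hφ.continuous).integrable_of_hasCompactSupport hφc.mul_left)
    ((hv.continuous.mul hφd).integrable_of_hasCompactSupport
      ((hφc.fderiv_apply ℝ e).mul_left))
    ((hv.continuous.mul hφ.continuous).integrable_of_hasCompactSupport hφc.mul_left)
    (fun x _ => hv.differentiable one_ne_zero x) (fun x _ => hφ1.differentiable one_ne_zero x)
  rw [key]
  simp only [mul_comm]

/-! ### The variational characterization on the ball -/

section ball

variable {N : ℕ} {β c r L : ℝ}

theorem ae_mem_closedBall : ∀ᵐ x ∂(volume.restrict (ball (0 : EuclideanSpace ℝ (Fin N)) r)),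
    x ∈ closedBall (0 : EuclideanSpace ℝ (Fin N)) r := by
  filter_upwards [ae_restrict_mem measurableSet_ball] with x hx using ball_subset_closedBall hx

theorem memLp_ball {F : Type*} [NormedAddCommGroup F] {f : EuclideanSpace ℝ (Fin N) → F}
    (hf : Continuous f) : MemLp f 2 (volume.restrict (ball 0 r)) :=
  have : IsFiniteMeasure (volume.restrict (ball (0 : EuclideanSpace ℝ (Fin N)) r)) :=
    isFiniteMeasure_restrict.2 measure_ball_lt_top.ne
  memLp_of_continuous_of_isCompact (isCompact_closedBall 0 r) ae_mem_closedBall hf 2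

theorem memLp_boundary_ball (hN : 1 ≤ N) (hr : 0 < r) {f : EuclideanSpace ℝ (Fin N) → ℝ}
    (hf : Continuous f) : MemLp f 2 (boundaryMeasure (ball 0 r)) := by
  have := isFiniteMeasure_boundaryMeasure_ball hN hr
  refine memLp_of_continuous_of_isCompact (isCompact_sphere 0 r) ?_ hf 2
  rw [boundaryMeasure, frontier_ball _ hr.ne']
  exact ae_restrict_mem isClosed_sphere.measurableSet

/-- The energy of a `C¹` function in polar coordinates. -/
theorem energy_eq_integral_sphere (hN : 1 ≤ N) (hc : 0 < c) (hr : 0 < r)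
    (h : unitSphereMeasure N = ENNReal.ofReal c • coneMeasure N)
    {φ : EuclideanSpace ℝ (Fin N) → ℝ} (hφ : ContDiff ℝ 1 φ) :
    (∫ x in ball 0 r, ‖∇ φ x‖ ^ 2) + β * (∫ x, φ x ^ 2 ∂boundaryMeasure (ball 0 r)) -
      L * ∫ x in ball 0 r, φ x ^ 2 =
    ∫ u : sphere (0 : EuclideanSpace ℝ (Fin N)) 1,
      ((∫ ρ in (0 : ℝ)..r, ρ ^ (N - 1) * (‖∇ φ (ρ • (u : EuclideanSpace ℝ (Fin N)))‖ ^ 2 -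
        L * φ (ρ • (u : EuclideanSpace ℝ (Fin N))) ^ 2)) +
        β * c * r ^ (N - 1) * φ (r • (u : EuclideanSpace ℝ (Fin N))) ^ 2)
        ∂(volume : Measure (EuclideanSpace ℝ (Fin N))).toSphere := by
  have : NeZero N := ⟨by omega⟩
  have hφc := hφ.continuous
  have hgc := continuous_gradient hφ
  have hi1 : Integrable (fun x => ‖∇ φ x‖ ^ 2) (volume.restrict (ball 0 r)) :=
    (memLp_ball hgc).integrable_norm_pow two_ne_zero
  have hi2 : Integrable (fun x => φ x ^ 2) (volume.restrict (ball 0 r)) :=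
    (memLp_ball hφc).integrable_sq
  have hF : Continuous fun x => ‖∇ φ x‖ ^ 2 - L * φ x ^ 2 := by fun_prop
  have hpolar := setIntegral_ball_eq_integral_sphere
    (volume : Measure (EuclideanSpace ℝ (Fin N))) hr hF
  rw [integral_sub hi1 (hi2.const_mul L), integral_const_mul, finrank_euclideanSpace_fin] at hpolar
  rw [integral_boundaryMeasure_ball hc hr h (by fun_prop : Continuous fun x => φ x ^ 2)]
  have hcont : Continuous fun u : sphere (0 : EuclideanSpace ℝ (Fin N)) 1 =>
      ∫ ρ in (0 : ℝ)..r, ρ ^ (N - 1) * (‖∇ φ (ρ • (u : EuclideanSpace ℝ (Fin N)))‖ ^ 2 -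
        L * φ (ρ • (u : EuclideanSpace ℝ (Fin N))) ^ 2) := by
    apply intervalIntegral.continuous_parametric_intervalIntegral_of_continuous'
    fun_prop
  have hsph : ∀ f : sphere (0 : EuclideanSpace ℝ (Fin N)) 1 → ℝ, Continuous f →
      Integrable f (volume : Measure (EuclideanSpace ℝ (Fin N))).toSphere := fun f hf =>
    memLp_one_iff_integrable.1
      (memLp_of_continuous_of_isCompact isCompact_univ (by simp) hf 1)
  rw [integral_add (hsph _ hcont) (hsph _ (by fun_prop)), ← hpolar, integral_const_mul]
  ring

theorem hasDerivAt_along_ray {φ : EuclideanSpace ℝ (Fin N) → ℝ} (hφ : ContDiff ℝ 1 φ)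
    (u : EuclideanSpace ℝ (Fin N)) (ρ : ℝ) :
    HasDerivAt (fun ρ : ℝ => φ (ρ • u)) (inner ℝ (∇ φ (ρ • u)) u) ρ := by
  have h1 : HasDerivAt (fun ρ : ℝ => ρ • u) u ρ := by
    simpa using (hasDerivAt_id ρ).smul_const u
  rw [inner_gradient]
  exact (hφ.differentiable one_ne_zero (ρ • u)).hasFDerivAt.comp_hasDerivAt ρ h1

/-- The Robin energy of a `C¹` function is at least `L` times its squared `L²` norm. -/
theorem le_energy_of_contDiff (hN : 2 ≤ N) (hc : 0 < c) (hr : 0 < r)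
    (h : unitSphereMeasure N = ENNReal.ofReal c • coneMeasure N)
    (hH : ∀ ρ ∈ Icc 0 r, 0 < profile N (L * ρ ^ 2)) (hb : negLogDeriv N L r = β * c)
    {φ : EuclideanSpace ℝ (Fin N) → ℝ} (hφ : ContDiff ℝ 1 φ) :
    L * ∫ x in ball 0 r, φ x ^ 2 ≤
      (∫ x in ball 0 r, ‖∇ φ x‖ ^ 2) + β * ∫ x, φ x ^ 2 ∂boundaryMeasure (ball 0 r) := by
  rw [← sub_nonneg, energy_eq_integral_sphere (by omega) hc hr h hφ]
  refine integral_nonneg fun u => ?_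
  have hu : ‖(u : EuclideanSpace ℝ (Fin N))‖ = 1 := mem_sphere_zero_iff_norm.1 u.2
  have hφc := hφ.continuous
  have hgc := continuous_gradient hφ
  have hw' : Continuous fun ρ : ℝ =>
      inner ℝ (∇ φ (ρ • (u : EuclideanSpace ℝ (Fin N)))) (u : EuclideanSpace ℝ (Fin N)) := by
    fun_prop
  have hray := ray_energy_eq hN hr hH hb
    (hasDerivAt_along_ray hφ (u : EuclideanSpace ℝ (Fin N))) hw'
  have hnn : 0 ≤ ∫ ρ in (0 : ℝ)..r, ρ ^ (N - 1) *
      (inner ℝ (∇ φ (ρ • (u : EuclideanSpace ℝ (Fin N)))) (u : EuclideanSpace ℝ (Fin N)) +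
        negLogDeriv N L ρ * φ (ρ • (u : EuclideanSpace ℝ (Fin N)))) ^ 2 :=
    intervalIntegral.integral_nonneg hr.le fun ρ hρ => by
      have := hρ.1
      positivity
  rw [← hray] at hnn
  -- The full gradient dominates the radial derivative, for which the ray identity gives a
  -- nonnegative value.
  refine hnn.trans (add_le_add_left (intervalIntegral.integral_mono_on hr.le
    (Continuous.intervalIntegrable (by fun_prop) _ _)
    (Continuous.intervalIntegrable (by fun_prop) _ _) fun ρ hρ => ?_) _)
  have h1 : |inner ℝ (∇ φ (ρ • (u : EuclideanSpace ℝ (Fin N)))) (u : EuclideanSpace ℝ (Fin N))| ≤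
      ‖∇ φ (ρ • (u : EuclideanSpace ℝ (Fin N)))‖ := by
    simpa [hu] using abs_real_inner_le_norm (∇ φ (ρ • (u : EuclideanSpace ℝ (Fin N))))
      (u : EuclideanSpace ℝ (Fin N))
  have h2 := sq_le_sq' (abs_le.1 h1).1 (abs_le.1 h1).2
  have h3 := pow_nonneg hρ.1 (N - 1)
  gcongr

/-- The radial eigenfunction. -/
def radialFunction (N : ℕ) (L : ℝ) (x : EuclideanSpace ℝ (Fin N)) : ℝ := profile N (L * ‖x‖ ^ 2)

theorem contDiff_radialFunction (hN : 1 ≤ N) : ContDiff ℝ 1 (radialFunction N L) :=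
  (contDiff_profile hN).comp (contDiff_const.mul (contDiff_norm_sq ℝ))

theorem gradient_radialFunction (hN : 1 ≤ N) (x : EuclideanSpace ℝ (Fin N)) :
    ∇ (radialFunction N L) x = (2 * L * profileDeriv N (L * ‖x‖ ^ 2)) • x := by
  refine HasGradientAt.gradient ?_
  rw [hasGradientAt_iff_hasFDerivAt]
  have h1 := ((hasStrictFDerivAt_norm_sq x).hasFDerivAt.const_mul L)
  have h : HasFDerivAt (radialFunction N L) _ x :=
    (hasDerivAt_profile hN (L * ‖x‖ ^ 2)).comp_hasFDerivAt x h1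
  refine h.congr_fderiv ?_
  ext y
  simp
  ring

/-- The gradient is radial and `w' + y w = 0` along each ray, so both inequalities of the lower
bound become equalities. -/
theorem energy_radialFunction (hN : 2 ≤ N) (hc : 0 < c) (hr : 0 < r)
    (h : unitSphereMeasure N = ENNReal.ofReal c • coneMeasure N)
    (hH : ∀ ρ ∈ Icc 0 r, 0 < profile N (L * ρ ^ 2)) (hb : negLogDeriv N L r = β * c) :
    (∫ x in ball 0 r, ‖∇ (radialFunction N L) x‖ ^ 2) +
        β * (∫ x, radialFunction N L x ^ 2 ∂boundaryMeasure (ball 0 r)) =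
      L * ∫ x in ball 0 r, radialFunction N L x ^ 2 := by
  have hN1 : 1 ≤ N := by omega
  have hφ := contDiff_radialFunction (N := N) (L := L) hN1
  rw [← sub_eq_zero, energy_eq_integral_sphere hN1 hc hr h hφ]
  refine integral_eq_zero_of_ae (Eventually.of_forall fun u => ?_)
  have hu : ‖(u : EuclideanSpace ℝ (Fin N))‖ = 1 := mem_sphere_zero_iff_norm.1 u.2
  have hn : ∀ ρ : ℝ, ‖ρ • (u : EuclideanSpace ℝ (Fin N))‖ ^ 2 = ρ ^ 2 := fun ρ => by
    rw [norm_smul, hu, mul_one, Real.norm_eq_abs, sq_abs]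
  have hw : ∀ ρ : ℝ, HasDerivAt (fun ρ : ℝ => profile N (L * ρ ^ 2))
      (profileDeriv N (L * ρ ^ 2) * (L * (2 * ρ))) ρ := fun ρ =>
    (hasDerivAt_profile hN1 (L * ρ ^ 2)).comp ρ
      (by simpa using (hasDerivAt_pow 2 ρ).const_mul L)
  have hw' : Continuous fun ρ : ℝ => profileDeriv N (L * ρ ^ 2) * (L * (2 * ρ)) := by
    have := continuous_profileDeriv hN1
    fun_prop
  have hray := ray_energy_eq hN hr hH hb hw hw'
  have h0 : (∫ ρ in (0 : ℝ)..r, ρ ^ (N - 1) * (profileDeriv N (L * ρ ^ 2) * (L * (2 * ρ)) +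
      negLogDeriv N L ρ * profile N (L * ρ ^ 2)) ^ 2) = 0 := by
    refine (intervalIntegral.integral_congr (g := fun _ => (0 : ℝ)) fun ρ hρ => ?_).trans
      intervalIntegral.integral_zero
    rw [uIcc_of_le hr.le] at hρ
    have := (hH ρ hρ).ne'
    have : profileDeriv N (L * ρ ^ 2) * (L * (2 * ρ)) +
        negLogDeriv N L ρ * profile N (L * ρ ^ 2) = 0 := by
      rw [negLogDeriv]; field_simp; ring
    simp [this]
  rw [h0] at hray
  refine Eq.trans ?_ hray
  simp only [radialFunction, gradient_radialFunction hN1, norm_smul _ (_ • (u : EuclideanSpace ℝ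
    (Fin N))), mul_pow, hn]
  congr 1
  refine intervalIntegral.integral_congr fun ρ _ => ?_
  simp only [Real.norm_eq_abs, sq_abs]
  ring

/-- If `L` and the radial function `ρ ↦ H (L ρ²)` satisfy the Robin condition on the sphere of
radius `r` and the radial function is positive, then `L` is the fundamental eigenvalue. -/
theorem eigenvalue_ball_eq (hN : 2 ≤ N) (hc : 0 < c) (hr : 0 < r)
    (h : unitSphereMeasure N = ENNReal.ofReal c • coneMeasure N)
    (hH : ∀ ρ ∈ Icc 0 r, 0 < profile N (L * ρ ^ 2)) (hb : negLogDeriv N L r = β * c) :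
    eigenvalue β (ball (0 : EuclideanSpace ℝ (Fin N)) r) = L := by
  have hN1 : 1 ≤ N := by omega
  have hpos : ∀ v : EuclideanSpace ℝ (Fin N) → ℝ, MemLp v 2 (volume.restrict (ball 0 r)) →
      ¬ v =ᵐ[volume.restrict (ball 0 r)] 0 → 0 < ∫ x in ball 0 r, v x ^ 2 := by
    intro v hv hv0
    refine lt_of_le_of_ne (integral_nonneg fun x => sq_nonneg _) fun h0 => hv0 ?_
    have := (integral_eq_zero_iff_of_nonneg (fun x => sq_nonneg (v x)) hv.integrable_sq).1 h0.symm
    filter_upwards [this] with x hx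
    simpa using hx
  refine IsLeast.csInf_eq ⟨?_, ?_⟩
  · have hφ := contDiff_radialFunction (N := N) (L := L) hN1
    have hne : ¬ radialFunction N L =ᵐ[volume.restrict (ball 0 r)] 0 := by
      intro h0
      have : (ae (volume.restrict (ball (0 : EuclideanSpace ℝ (Fin N)) r))).NeBot :=
        ae_restrict_neBot.2 (measure_ball_pos volume _ hr).ne'
      obtain ⟨x, hx0, hx⟩ := (h0.and (ae_restrict_mem measurableSet_ball)).exists
      exact (hH ‖x‖ ⟨norm_nonneg x, (mem_ball_zero_iff.1 hx).le⟩).ne' hx0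
    -- The radial function is `C¹`, so it is its own trace, witnessed by a constant approximating
    -- sequence.
    refine ⟨radialFunction N L, ∇ (radialFunction N L), radialFunction N L,
      ⟨memLp_ball hφ.continuous, memLp_ball (continuous_gradient hφ),
        isWeakGradient_gradient _ hφ⟩,
      ⟨memLp_boundary_ball hN1 hr hφ.continuous, fun _ => radialFunction N L, fun _ => hφ,
        by simp, by simp, by simp⟩, hne, ?_⟩
    rw [rayleighQuotient, energy_radialFunction hN hc hr h hH hb,
      mul_div_cancel_right₀ _ (hpos _ (memLp_ball hφ.continuous) hne).ne']
  · rintro q ⟨v, G, τ, hv, ⟨hτ, φ, hφ, hφv, hφG, hφτ⟩, hv0, rfl⟩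
    rw [rayleighQuotient, le_div_iff₀ (hpos v hv.memLp hv0)]
    -- The `C¹` sequence that defines the trace makes all three integrals converge, so the lower
    -- bound passes to the limit.
    have h1 := tendsto_integral_norm_sq (fun n => memLp_ball (r := r) (hφ n).continuous)
      hv.memLp hφv
    have h2 := tendsto_integral_norm_sq
      (fun n => memLp_ball (r := r) (continuous_gradient (hφ n))) hv.memLp_gradient hφG
    have h3 := tendsto_integral_norm_sq
      (fun n => memLp_boundary_ball hN1 hr (hφ n).continuous) hτ hφτ
    simp only [Real.norm_eq_abs, sq_abs] at h1 h3
    exact le_of_tendsto_of_tendsto' (h1.const_mul L) (h2.add (h3.const_mul β)) fun n =>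
      le_energy_of_contDiff hN hc hr h hH hb (hφ n)

end ball

/-! ### Conclusion -/

/-- The fundamental Robin eigenvalue of a ball plus a multiple of its volume is a strongly convex
function of the radius. -/
theorem exists_strongConvexOn_eigenvalue_ball {N : ℕ} (hN : 2 ≤ N) {β : ℝ} (hβ : 0 < β) {k : ℝ}
    (hk : 0 < k) : ∃ m : ℝ, 0 < m ∧ StrongConvexOn (Ioi (0 : ℝ)) m
      (fun r : ℝ => eigenvalue β (ball (0 : EuclideanSpace ℝ (Fin N)) r) +
        k * volume.real (ball (0 : EuclideanSpace ℝ (Fin N)) r)) := by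
  have hN1 : 1 ≤ N := by omega
  -- The ratio `c` does not depend on the radius, so `β * c` serves as boundary parameter for all
  -- balls at once.
  obtain ⟨c, hc, h⟩ := exists_unitSphereMeasure_eq hN1
  have hb : 0 < β * c := mul_pos hβ hc
  set V := volume.real (ball (0 : EuclideanSpace ℝ (Fin N)) 1)
  have hV : 0 < V := ENNReal.toReal_pos (measure_ball_pos _ _ one_pos).ne' measure_ball_lt_top.ne
  obtain ⟨m, hm, hconv⟩ := exists_strongConvexOn_radialEigenvalue hN hb (mul_pos hk hV)
  have heq : EqOn (fun r => radialEigenvalue N (β * c) r + k * V * r ^ N)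
      (fun r : ℝ => eigenvalue β (ball (0 : EuclideanSpace ℝ (Fin N)) r) +
        k * volume.real (ball (0 : EuclideanSpace ℝ (Fin N)) r)) (Ioi 0) := by
    intro r (hr : 0 < r)
    have hH : ∀ ρ ∈ Icc 0 r, 0 < profile N (radialEigenvalue N (β * c) r * ρ ^ 2) :=
      fun ρ hρ => profile_radialEigenvalue_pos hN1 hb hr hρ
    have hbd : negLogDeriv N (radialEigenvalue N (β * c) r) r = β * c := by
      have h1 := robinParam_radialEigenvalue hN1 hb hr
      have h2 := (hH r ⟨hr.le, le_rfl⟩).ne'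
      rw [robinParam, div_eq_iff h2] at h1
      rw [negLogDeriv, div_eq_iff h2]
      refine mul_right_cancel₀ hr.ne' ?_
      linarith
    have hvol : volume.real (ball (0 : EuclideanSpace ℝ (Fin N)) r) = r ^ N * V := by
      rw [measureReal_def, Measure.addHaar_ball_of_pos _ _ hr, finrank_euclideanSpace_fin,
        ENNReal.toReal_mul, ENNReal.toReal_ofReal (by positivity)]
      rfl
    simp only [eigenvalue_ball_eq hN hc hr h hH hbd, hvol]
    ring
  refine ⟨m, hm, hconv.1, fun x hx y hy a b ha hb' hab => ?_⟩
  have hz := hconv.1 hx hy ha hb' hab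
  have := hconv.2 hx hy ha hb' hab
  rwa [heq hx, heq hy, heq hz] at this

end Robin
end

/-- For `N ≥ 2` and `β, k > 0`, the function `r ↦ λ_{1,β}(B_r) + k |B_r|` is uniformly convex on
`(0, ∞)`, with a quadratic modulus of convexity. -/
theorem corollary2p2 (N : ℕ) (hN : 2 ≤ N) (β : ℝ) (hβ : 0 < β) (k : ℝ) (hk : 0 < k) :
    ∃ m : ℝ, 0 < m ∧
      StrongConvexOn (Set.Ioi (0 : ℝ)) m
        (fun r : ℝ => Robin.eigenvalue β (Metric.ball (0 : EuclideanSpace ℝ (Fin N)) r) +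
          k * MeasureTheory.volume.real (Metric.ball (0 : EuclideanSpace ℝ (Fin N)) r)) :=
  Robin.exists_strongConvexOn_eigenvalue_ball hN hβ hk
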